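/- For an integer $n\ge 2$ and an integer $a$ coprime to $n$, let $H_2(a;n)=\{(x,y)\in\mathbb Z^2 : xy\equiv a \pmod n,\ 1\le x,y<n\}$, let $\bar S_2(a;n)=\{x+y \bmod n : (x,y)\in H_2(a;n)\}$ and $\bar D_2(a;n)=\{x-y \bmod n : (x,y)\in H_2(a;n)\}$, and put $c_2(a;n)=\#\bar S_2(a;n)/\#\bar D_2(a;n)$. Let $p_i$ be the $i$-th prime congruent to $3$ modulo $4$ and let $N_k=\prod_{i=1}^k p_i$. Fix a perfect square $a\in\mathbb Z$ that is coprime to every $p_i$ ($i\ge 1$). Then there are constants $c,C,c',C'>0$, depending at most on $a$, such that for all $k\ge 1$ $$c\,\log\log N_k\ \le\ c_2(a;N_k)\ \le\ C\,\log\log N_k,$$ and for all $t\ge 2$ and all $k\ge 1$ $$\frac{c'}{\log\log N_k}\ \le\ c_2(a;N_k^t)\ \le\ \frac{C'}{\log\log N_k}.$$ -/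

import Mathlib

/-- The two-dimensional modular hyperbola: integer pairs `(x, y)` with `1 ≤ x, y < n` and
`x y ≡ a (mod n)`. -/
def modHyperbola (a : ℤ) (n : ℕ) : Set (ℤ × ℤ) :=
  {v | v.1 * v.2 ≡ a [ZMOD (n : ℤ)] ∧ (1 ≤ v.1 ∧ v.1 < (n : ℤ)) ∧ (1 ≤ v.2 ∧ v.2 < (n : ℤ))}

/-- The reduced coordinate sumset `{x + y mod n}` of the modular hyperbola. -/
def reducedSumset (a : ℤ) (n : ℕ) : Set (ZMod n) :=
  (fun v : ℤ × ℤ => ((v.1 + v.2 : ℤ) : ZMod n)) '' modHyperbola a n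

/-- The reduced coordinate difference set `{x - y mod n}` of the modular hyperbola. -/
def reducedDiffset (a : ℤ) (n : ℕ) : Set (ZMod n) :=
  (fun v : ℤ × ℤ => ((v.1 - v.2 : ℤ) : ZMod n)) '' modHyperbola a n

/-- The ratio of the number of sums to the number of differences. -/
noncomputable def c₂ (a : ℤ) (n : ℕ) : ℝ :=
  ((reducedSumset a n).ncard : ℝ) / ((reducedDiffset a n).ncard : ℝ)

/-- The primes congruent to `3` modulo `4` in increasing order, indexed from `0`. -/
noncomputable def primeThreeModFour (i : ℕ) : ℕ :=
  Nat.nth (fun p : ℕ => p.Prime ∧ p ≡ 3 [MOD 4]) i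

/-- The product of the first `k` primes congruent to `3` modulo `4`. -/
noncomputable def primorialThreeModFour (k : ℕ) : ℕ :=
  ∏ i ∈ Finset.range k, primeThreeModFour i

/-!
Since `x - y = x + (-y)` and `x * (-y) = -(x * y)`, both sets are instances of one construction:
the set `hyperbolaSums c` of sums `x + y` with `x * y = c` in `ZMod n`, taken at `c = a` for the
sumset and at `c = -a` for the difference set. The Chinese remainder theorem makes its cardinality
multiplicative in `n`, so `c₂ a (N_k ^ t)` is a product of local ratios over the primes dividing
`N_k` (`c₂_primorialThreeModFour_pow`).

At a prime `p ≡ 3 (mod 4)` write `a = b ^ 2`. The map `x ↦ x + c / x` on units is two-to-one away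
from the classes `x ≡ ±√c (mod p)`. For `c = -a` there are no such classes, and there are exactly
`p ^ (t - 1) (p - 1) / 2` differences. For `c = a` the classes `x ≡ ±b` are exceptional: modulo `p`
they give the two extra sums `±2 b`, so the ratio is `(p + 1) / (p - 1) = 1 + 2 / p + O(1 / p ^ 2)`;
modulo `p ^ t` with `t ≥ 2` all their sums are `±2 b` modulo `p ^ 2`, hence negligible, and the
ratio is `(p - 3) / (p - 1) + O(1 / p ^ 2) = 1 - 2 / p + O(1 / p ^ 2)`. At `p = 3` this main term is
zero, and the exceptional classes provide a lower bound independent of `t`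
(`one_div_nine_le_ratio_prime_pow`).

It remains to see that `∑ 1 / p = (log log x) / 2 + O(1)` over the primes `p ≤ x`, `p ≡ 3 (mod 4)`
(`exists_abs_sum_inv_sub_half_log_log_le`), and that `log log N_k` is of the order of `log x` for
`x` the largest prime factor of `N_k`. Both follow from `∑ log p / p = (log x) / 2 + O(1)`, which
is, up to a bounded term, half the difference of Mertens' estimate `∑ Λ(n) / n = log x + O(1)` and
`∑ χ(n) Λ(n) / n = O(1)` for the nontrivial character `χ` modulo `4`; the latter is elementary
because `L(1, χ)` is an alternating series with positive value. All error terms are independent of `t`.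
-/

/-! ### Sums of two factors of a fixed element -/

/-- The sums `x + y` over all factorisations `x * y = c` in a commutative ring. For a unit `c` of
`ZMod n` this is the reduced sumset of the modular hyperbola `x y = c`, and for `-c` it is the
reduced difference set, since `x - y = x + (-y)` and `x * (-y) = -(x * y)`. -/
def hyperbolaSums {R : Type*} [CommRing R] (c : R) : Set R :=
  {s | ∃ x y, x * y = c ∧ x + y = s}

/-- The condition `1 ≤ x, y < n` merely selects representatives: for `a` coprime to `n` both
coordinates are units, so the excluded residue `0` does not occur. -/
theorem image_modHyperbola_eq {n : ℕ} (hn : 2 ≤ n) {a : ℤ} (ha : IsCoprime a n)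
    (g : ZMod n × ZMod n → ZMod n) :
    (fun v : ℤ × ℤ => g ((v.1 : ZMod n), (v.2 : ZMod n))) '' modHyperbola a n =
      g '' {w | w.1 * w.2 = (a : ZMod n)} := by
  have : NeZero n := ⟨by omega⟩
  have : Fact (1 < n) := ⟨by omega⟩
  ext s
  constructor
  · rintro ⟨v, ⟨hv, -⟩, rfl⟩
    refine ⟨_, ?_, rfl⟩
    have := (ZMod.intCast_eq_intCast_iff _ _ _).2 hv
    simpa using this
  · rintro ⟨⟨x, y⟩, hxy, rfl⟩
    have hu : IsUnit (a : ZMod n) := by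
      obtain ⟨u, v, huv⟩ := ha
      have h := congrArg (Int.cast : ℤ → ZMod n) huv
      push_cast at h
      rw [ZMod.natCast_self, mul_zero, add_zero] at h
      exact IsUnit.of_mul_eq_one_right _ h
    simp only [Set.mem_ofPred_eq] at hxy
    rw [← hxy] at hu
    have hx : x ≠ 0 := (isUnit_of_mul_isUnit_left hu).ne_zero
    have hy : y ≠ 0 := (isUnit_of_mul_isUnit_right hu).ne_zero
    have key : ∀ z : ZMod n, z ≠ 0 → 1 ≤ (z.val : ℤ) ∧ (z.val : ℤ) < n := fun z hz =>
      ⟨by exact_mod_cast Nat.one_le_iff_ne_zero.2 ((ZMod.val_ne_zero z).2 hz),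
        by exact_mod_cast ZMod.val_lt z⟩
    refine ⟨((x.val : ℤ), (y.val : ℤ)), ⟨?_, key x hx, key y hy⟩, by simp⟩
    rw [← ZMod.intCast_eq_intCast_iff]
    simpa using hxy

theorem reducedSumset_eq_hyperbolaSums {n : ℕ} (hn : 2 ≤ n) {a : ℤ} (ha : IsCoprime a n) :
    reducedSumset a n = hyperbolaSums (a : ZMod n) := by
  have h := image_modHyperbola_eq hn ha (fun w => w.1 + w.2)
  simp only [reducedSumset, Int.cast_add] at h ⊢
  rw [h]
  ext s
  simp [hyperbolaSums]

theorem reducedDiffset_eq_hyperbolaSums {n : ℕ} (hn : 2 ≤ n) {a : ℤ} (ha : IsCoprime a n) :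
    reducedDiffset a n = hyperbolaSums (-(a : ZMod n)) := by
  have h := image_modHyperbola_eq hn ha (fun w => w.1 - w.2)
  simp only [reducedDiffset, Int.cast_sub] at h ⊢
  rw [h]
  ext s
  constructor
  · rintro ⟨⟨x, y⟩, hxy, rfl⟩
    simp only [Set.mem_ofPred_eq] at hxy
    exact ⟨x, -y, by rw [← hxy]; ring, by ring⟩
  · rintro ⟨x, y, hxy, rfl⟩
    exact ⟨(x, -y), by simp [hxy], by simp⟩

theorem hyperbolaSums_prod {R S : Type*} [CommRing R] [CommRing S] (c : R × S) :
    hyperbolaSums c = hyperbolaSums c.1 ×ˢ hyperbolaSums c.2 := by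
  ext ⟨s, t⟩
  constructor
  · rintro ⟨x, y, rfl, h⟩
    obtain ⟨rfl, rfl⟩ := Prod.ext_iff.1 h
    exact ⟨⟨_, _, rfl, rfl⟩, ⟨_, _, rfl, rfl⟩⟩
  · rintro ⟨⟨x, y, h1, h2⟩, ⟨x', y', h3, h4⟩⟩
    exact ⟨(x, x'), (y, y'), Prod.ext h1 h3, Prod.ext h2 h4⟩

theorem image_hyperbolaSums {R S : Type*} [CommRing R] [CommRing S] (e : R ≃+* S) (c : R) :
    e '' hyperbolaSums c = hyperbolaSums (e c) := by
  ext s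
  constructor
  · rintro ⟨_, ⟨x, y, rfl, rfl⟩, rfl⟩
    exact ⟨e x, e y, by simp, by simp⟩
  · rintro ⟨x, y, h, rfl⟩
    refine ⟨e.symm x + e.symm y, ⟨_, _, ?_, rfl⟩, by simp⟩
    apply e.injective
    simpa using h

/-- The number of sums `x + y` with `x * y = c` in `ZMod n`. -/
noncomputable def numHyperbolaSums (c : ℤ) (n : ℕ) : ℕ := (hyperbolaSums (c : ZMod n)).ncard

theorem c₂_eq_numHyperbolaSums_div {n : ℕ} (hn : 2 ≤ n) {a : ℤ} (ha : IsCoprime a n) :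
    c₂ a n = (numHyperbolaSums a n : ℝ) / numHyperbolaSums (-a) n := by
  rw [c₂, reducedSumset_eq_hyperbolaSums hn ha, reducedDiffset_eq_hyperbolaSums hn ha,
    numHyperbolaSums, numHyperbolaSums, Int.cast_neg]

theorem numHyperbolaSums_one (c : ℤ) : numHyperbolaSums c 1 = 1 := by
  have : hyperbolaSums (c : ZMod 1) = {0} := by
    ext s
    simp only [Set.mem_singleton_iff]
    exact ⟨fun _ => Subsingleton.elim _ _, fun _ => ⟨0, 0, Subsingleton.elim _ _,
      Subsingleton.elim _ _⟩⟩
  rw [numHyperbolaSums, this, Set.ncard_singleton]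

theorem numHyperbolaSums_mul {m n : ℕ} (h : m.Coprime n) (c : ℤ) :
    numHyperbolaSums c (m * n) = numHyperbolaSums c m * numHyperbolaSums c n := by
  have e := image_hyperbolaSums (ZMod.chineseRemainder h) (c : ZMod (m * n))
  rw [numHyperbolaSums,
    ← Set.ncard_image_of_injective _ (ZMod.chineseRemainder h).injective, e, hyperbolaSums_prod,
    Set.ncard_prod]
  simp [numHyperbolaSums]

theorem numHyperbolaSums_prod {ι : Type*} (s : Finset ι) (f : ι → ℕ)
    (h : (s : Set ι).Pairwise fun i j => (f i).Coprime (f j)) (c : ℤ) :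
    numHyperbolaSums c (∏ i ∈ s, f i) = ∏ i ∈ s, numHyperbolaSums c (f i) := by
  classical
  induction s using Finset.induction_on with
  | empty => simp [numHyperbolaSums_one]
  | insert i s hi ih =>
    simp only [Finset.prod_insert hi]
    rw [numHyperbolaSums_mul, ih]
    · exact h.mono (by simp)
    · refine Nat.Coprime.prod_right fun j hj => h (by simp) (by simp [hj]) ?_
      rintro rfl
      exact hi hj

/-! ### Counting over a residue field -/

/-- A map whose fibres on `s` are the orbits of a fixed-point-free involution is two-to-one. -/
theorem two_mul_ncard_image_of_involution {α β : Type*} [Finite α] (s : Set α) (f : α → β)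
    (σ : α → α) (h1 : ∀ x ∈ s, σ x ∈ s) (h2 : ∀ x ∈ s, σ x ≠ x)
    (h3 : ∀ x ∈ s, ∀ y ∈ s, f x = f y ↔ y = x ∨ y = σ x) :
    2 * (f '' s).ncard = s.ncard := by
  classical
  have := Fintype.ofFinite α
  rw [Set.ncard_eq_toFinset_card', Set.ncard_eq_toFinset_card', Set.toFinset_image,
    Finset.card_eq_sum_card_image f s.toFinset, Finset.sum_const_nat (m := 2), mul_comm]
  intro b hb
  obtain ⟨x, hx, rfl⟩ := Finset.mem_image.1 hb
  rw [Set.mem_toFinset] at hx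
  rw [← Finset.card_pair (h2 x hx).symm]
  congr 1
  ext y
  simp only [Finset.mem_filter, Set.mem_toFinset, Finset.mem_insert, Finset.mem_singleton]
  constructor
  · rintro ⟨hy, h⟩
    exact (h3 x hx y hy).1 h.symm
  · intro h
    have hy : y ∈ s := by
      rcases h with rfl | rfl
      exacts [hx, h1 x hx]
    exact ⟨hy, ((h3 x hx y hy).2 h).symm⟩

theorem ncard_preimage_mul_card {R k : Type*} [CommRing R] [Finite R] [CommRing k] [Finite k]
    (π : R →+* k) (hπ : Function.Surjective π) (T : Set k) :
    (π ⁻¹' T).ncard * Nat.card k = T.ncard * Nat.card R := by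
  classical
  have := Fintype.ofFinite R
  have := Fintype.ofFinite k
  have key : ∀ T : Finset k, (Finset.univ.filter fun x => π x ∈ T).card =
      T.card * (Finset.univ.filter fun x => π x = 0).card := by
    intro T
    rw [Finset.card_eq_sum_card_fiberwise (f := π) (t := T) (fun x hx => by simpa using hx),
      Finset.sum_const_nat]
    intro b hb
    rw [← AddMonoidHom.card_fiber_eq_of_mem_range π (hπ b) (hπ 0)]
    congr 1
    ext x
    simp only [Finset.mem_filter, Finset.mem_univ, true_and, and_iff_right_iff_imp]
    rintro rfl
    exact hb
  have h1 := key Finset.univ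
  have h2 := key T.toFinset
  simp only [Finset.mem_univ, Finset.filter_true, Finset.card_univ] at h1
  rw [Set.ncard_eq_toFinset_card', Set.ncard_eq_toFinset_card', Nat.card_eq_fintype_card,
    Nat.card_eq_fintype_card, h1]
  have : (π ⁻¹' T).toFinset = Finset.univ.filter fun x => π x ∈ T.toFinset := by
    ext; simp
  rw [this, h2]
  ring

/-- The sum of the two coordinates of the point of the hyperbola `x y = c` with first
coordinate `x`; meaningful for a unit `x`. -/
noncomputable def hyperbolaSum {R : Type*} [CommRing R] (c x : R) : R := x + c * Ring.inverse x

section Local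

variable {R k : Type*} [CommRing R] [Field k] {π : R →+* k}

theorem hyperbolaSums_eq_image (hu : ∀ x, π x ≠ 0 → IsUnit x) {c : R} (hc : π c ≠ 0) :
    hyperbolaSums c = hyperbolaSum c '' (π ⁻¹' {0}ᶜ) := by
  ext s
  constructor
  · rintro ⟨x, y, rfl, rfl⟩
    have hx : π x ≠ 0 := fun h => hc (by simp [h])
    refine ⟨x, hx, ?_⟩
    rw [hyperbolaSum, mul_comm x y, mul_assoc, Ring.mul_inverse_cancel _ (hu x hx), mul_one]
  · rintro ⟨x, hx, rfl⟩
    refine ⟨x, c * Ring.inverse x, ?_, rfl⟩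
    rw [mul_comm c, ← mul_assoc, Ring.mul_inverse_cancel _ (hu x hx), one_mul]

/-- Clearing denominators in `x + c / x = y + c / y`. -/
theorem hyperbolaSum_eq_iff (hu : ∀ x, π x ≠ 0 → IsUnit x) {c x y : R} (hx : π x ≠ 0)
    (hy : π y ≠ 0) :
    hyperbolaSum c x = hyperbolaSum c y ↔ (x - y) * (x * y - c) = 0 := by
  have hxy := (hu x hx).mul (hu y hy)
  have e : (x - y) * (x * y - c) = (x * y) * (hyperbolaSum c x - hyperbolaSum c y) := by
    simp only [hyperbolaSum]
    linear_combination (-c * y) * Ring.mul_inverse_cancel _ (hu x hx) +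
      (c * x) * Ring.mul_inverse_cancel _ (hu y hy)
  rw [e, hxy.mul_right_eq_zero, sub_eq_zero]

/-- Away from the square roots of `c` in the residue field, `x ↦ x + c / x` is exactly
two-to-one, its fibres being `{x, c / x}`. -/
theorem two_mul_ncard_image_hyperbolaSum [Finite R] (hu : ∀ x, π x ≠ 0 → IsUnit x) {c : R}
    {T : Set k} (h0 : 0 ∉ T) (hT : ∀ x ∈ T, π c / x ∈ T)
    (hT' : ∀ x ∈ T, x ^ 2 ≠ π c) :
    2 * (hyperbolaSum c '' (π ⁻¹' T)).ncard = (π ⁻¹' T).ncard := by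
  have hne : ∀ x ∈ π ⁻¹' T, π x ≠ 0 := fun x hx h => h0 (by rw [← h]; exact hx)
  have hσ : ∀ x, π x ≠ 0 → π (c * Ring.inverse x) = π c / π x := fun x hx => by
    have := congrArg π (Ring.mul_inverse_cancel _ (hu x hx))
    rw [map_mul, map_one] at this
    rw [map_mul, eq_div_iff hx]
    linear_combination π c * this
  refine two_mul_ncard_image_of_involution _ _ (fun x => c * Ring.inverse x) ?_ ?_ ?_
  · intro x hx
    rw [Set.mem_preimage, hσ x (hne x hx)]
    exact hT _ hx
  · intro x hx h
    apply hT' _ hx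
    have h' := congrArg π h
    rw [hσ x (hne x hx), div_eq_iff (hne x hx)] at h'
    rw [h']; ring
  · intro x hx y hy
    rw [hyperbolaSum_eq_iff hu (hne x hx) (hne y hy)]
    have hinv := Ring.mul_inverse_cancel _ (hu x (hne x hx))
    constructor
    · intro h
      by_cases hxy : π (x - y) = 0
      · left
        have : π (x * y - c) ≠ 0 := by
          intro h'
          rw [map_sub, sub_eq_zero] at hxy h'
          rw [map_mul, ← hxy] at h'
          exact hT' _ hx (by rw [sq, h'])
        have := (hu _ this).mul_left_eq_zero.1 h
        exact (sub_eq_zero.1 this).symm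
      · right
        have := (hu _ hxy).mul_right_eq_zero.1 h
        linear_combination Ring.inverse x * this - y * hinv
    · rintro (rfl | rfl)
      · ring
      · linear_combination (x - c * Ring.inverse x) * c * hinv

theorem two_mul_ncard_hyperbolaSums_of_not_isSquare [Finite R] (hu : ∀ x, π x ≠ 0 → IsUnit x)
    {c : R} (hc : ¬ IsSquare (π c)) :
    2 * (hyperbolaSums c).ncard = (π ⁻¹' {0}ᶜ).ncard := by
  have hc0 : π c ≠ 0 := fun h => hc (h ▸ IsSquare.zero)
  rw [hyperbolaSums_eq_image hu hc0]
  refine two_mul_ncard_image_hyperbolaSum hu (by simp) ?_ ?_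
  · intro x hx
    simp only [Set.mem_compl_iff, Set.mem_singleton_iff] at hx ⊢
    exact div_ne_zero hc0 hx
  · intro x _ h
    exact hc ⟨x, by rw [← h, sq]⟩

/-- For `c = b ^ 2` the sums split into those coming from `x ≢ ±b`, where the map is two-to-one,
and those coming from `x ≡ ±b`. -/
theorem two_mul_ncard_hyperbolaSums_sq [Finite R] (hu : ∀ x, π x ≠ 0 → IsUnit x)
    {b : R} (hb : π b ≠ 0) :
    2 * (hyperbolaSums (b ^ 2)).ncard = (π ⁻¹' {0, π b, -π b}ᶜ).ncard +
      2 * (hyperbolaSum (b ^ 2) '' (π ⁻¹' {π b, -π b})).ncard := by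
  have hc : π (b ^ 2) ≠ 0 := by rw [map_pow]; exact pow_ne_zero 2 hb
  have hsq : ∀ x : k, x ^ 2 = π (b ^ 2) ↔ x = π b ∨ x = -π b := fun x => by
    rw [map_pow, sq_eq_sq_iff_eq_or_eq_neg]
  have hsplit : ({0}ᶜ : Set k) = {0, π b, -π b}ᶜ ∪ {π b, -π b} := by
    ext x
    simp only [Set.mem_compl_iff, Set.mem_singleton_iff, Set.mem_union, Set.mem_insert_iff]
    by_cases h1 : x = π b
    · simp [h1, hb]
    · by_cases h2 : x = -π b
      · simp [h2, hb]
      · simp [h1, h2]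
  rw [hyperbolaSums_eq_image hu hc, hsplit, Set.preimage_union, Set.image_union,
    Set.ncard_union_eq, mul_add, two_mul_ncard_image_hyperbolaSum hu]
  · simp
  · intro x hx
    simp only [Set.mem_compl_iff, Set.mem_singleton_iff, Set.mem_insert_iff, not_or] at hx ⊢
    obtain ⟨hx0, h1, h2⟩ := hx
    refine ⟨div_ne_zero hc hx0, fun h => h1 ?_, fun h => h2 ?_⟩
    · rw [div_eq_iff hx0, map_pow, sq] at h
      exact (mul_left_cancel₀ hb h).symm
    · rw [div_eq_iff hx0, map_pow] at h
      apply mul_left_cancel₀ (neg_ne_zero.2 hb)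
      rw [← h]; ring
  · intro x hx h
    rw [hsq] at h
    simp only [Set.mem_compl_iff, Set.mem_singleton_iff, Set.mem_insert_iff, not_or] at hx
    exact h.elim hx.2.1 hx.2.2
  · rw [Set.disjoint_left]
    rintro _ ⟨x, hx, rfl⟩ ⟨y, hy, hxy⟩
    simp only [Set.mem_preimage, Set.mem_compl_iff, Set.mem_singleton_iff, Set.mem_insert_iff,
      not_or] at hx hy
    have hy0 : π y ≠ 0 := by rcases hy with h | h <;> simp [h, hb]
    have h := (hyperbolaSum_eq_iff hu hy0 hx.1).1 hxy
    have hne : π (y - x) ≠ 0 := by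
      rw [map_sub, sub_ne_zero]
      rintro h
      rw [h] at hy
      exact hy.elim hx.2.1 hx.2.2
    have h2 := congrArg π ((hu _ hne).mul_right_eq_zero.1 h)
    rw [map_sub, map_zero, sub_eq_zero, map_mul, map_pow] at h2
    rcases hy with h | h
    · rw [h, sq] at h2
      exact hx.2.1 (mul_left_cancel₀ hb h2)
    · rw [h] at h2
      exact hx.2.2 (mul_left_cancel₀ (neg_ne_zero.2 hb) (by rw [h2]; ring))

end Local

/-! ### Prime power moduli -/

section PrimePower

variable {p t : ℕ}

theorem isUnit_of_castHom_ne_zero [Fact p.Prime] (ht : t ≠ 0) (x : ZMod (p ^ t))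
    (hx : ZMod.castHom (dvd_pow_self p ht) (ZMod p) x ≠ 0) : IsUnit x := by
  have : NeZero (p ^ t) := ⟨pow_ne_zero _ (Fact.out : p.Prime).ne_zero⟩
  have hv := ZMod.natCast_zmod_val x
  rw [← hv, ZMod.isUnit_natCast_iff_not_dvd_pow Fact.out (Nat.pos_of_ne_zero ht)]
  intro h
  apply hx
  rw [← hv, map_natCast]
  exact (ZMod.natCast_eq_zero_iff _ _).2 h

theorem ncard_preimage_castHom {m n q : ℕ} [NeZero m] [NeZero n] (h : m ∣ n) (hq : n = q * m)
    (T : Set (ZMod m)) : (ZMod.castHom h (ZMod m) ⁻¹' T).ncard = T.ncard * q := by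
  have key := ncard_preimage_mul_card (ZMod.castHom h (ZMod m)) (ZMod.castHom_surjective h) T
  rw [Nat.card_zmod, Nat.card_zmod] at key
  apply Nat.eq_of_mul_eq_mul_right (NeZero.pos m)
  rw [key, mul_assoc, ← hq]

theorem two_mul_numHyperbolaSums_of_not_isSquare [Fact p.Prime] {c : ℤ}
    (hc : ¬ IsSquare (c : ZMod p)) :
    2 * numHyperbolaSums c (p ^ (t + 1)) = (p - 1) * p ^ t := by
  have hp : p.Prime := Fact.out
  have : NeZero (p ^ (t + 1)) := ⟨pow_ne_zero _ hp.ne_zero⟩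
  have : NeZero p := ⟨hp.ne_zero⟩
  have h := two_mul_ncard_hyperbolaSums_of_not_isSquare
    (isUnit_of_castHom_ne_zero (p := p) (t := t + 1) (by omega)) (c := (c : ZMod (p ^ (t + 1))))
    (by simpa using hc)
  rw [numHyperbolaSums, h]
  have h2 := ncard_preimage_castHom (dvd_pow_self p (show t + 1 ≠ 0 by omega)) (pow_succ p t)
    ({0}ᶜ : Set (ZMod p))
  rw [Set.ncard_compl, Set.ncard_singleton, Nat.card_zmod] at h2
  exact h2

/-- The number of sums `x + b ^ 2 / x` modulo `p ^ t` with `x ≡ ±b` modulo `p`. It is used for `b`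
prime to `p`, so that every such `x` is a unit. -/
noncomputable def numRamifiedSums (b : ℤ) (p t : ℕ) : ℕ :=
  (hyperbolaSum ((b : ZMod (p ^ t)) ^ 2) ''
    {x | (x.cast : ZMod p) = b ∨ (x.cast : ZMod p) = -b}).ncard

theorem two_mul_numHyperbolaSums_sq [Fact p.Prime] (hp2 : p ≠ 2) {b : ℤ}
    (hb : (b : ZMod p) ≠ 0) :
    2 * numHyperbolaSums (b ^ 2) (p ^ (t + 1)) =
      (p - 3) * p ^ t + 2 * numRamifiedSums b p (t + 1) := by
  have hp : p.Prime := Fact.out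
  have : NeZero (p ^ (t + 1)) := ⟨pow_ne_zero _ hp.ne_zero⟩
  have : NeZero p := ⟨hp.ne_zero⟩
  have h := two_mul_ncard_hyperbolaSums_sq
    (isUnit_of_castHom_ne_zero (p := p) (t := t + 1) (by omega)) (b := (b : ZMod (p ^ (t + 1))))
    (by simpa using hb)
  rw [numHyperbolaSums, Int.cast_pow, h]
  have h2 := ncard_preimage_castHom (dvd_pow_self p (show t + 1 ≠ 0 by omega)) (pow_succ p t)
    ({0, (b : ZMod p), -(b : ZMod p)}ᶜ : Set (ZMod p))
  have hne : (b : ZMod p) ≠ -b := by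
    intro h
    have : (2 : ZMod p) * b = 0 := by linear_combination h
    rcases mul_eq_zero.1 this with h | h
    · have := (ZMod.natCast_eq_zero_iff 2 p).1 (by exact_mod_cast h)
      exact hp2 ((Nat.prime_dvd_prime_iff_eq hp Nat.prime_two).1 this)
    · exact hb h
  rw [Set.ncard_compl, Set.ncard_eq_three.2
    ⟨_, _, _, hb.symm, (neg_ne_zero.2 hb).symm, hne, rfl⟩, Nat.card_zmod] at h2
  rw [map_intCast, h2, numRamifiedSums]
  congr 2

theorem mul_hyperbolaSum {R : Type*} [CommRing R] {c x : R} (hx : IsUnit x) :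
    x * hyperbolaSum c x = x ^ 2 + c := by
  rw [hyperbolaSum]
  linear_combination c * Ring.mul_inverse_cancel _ hx

theorem isUnit_of_cast_eq [Fact p.Prime] {b : ℤ} (hb : (b : ZMod p) ≠ 0) {x : ZMod (p ^ (t + 1))}
    (hx : (x.cast : ZMod p) = b ∨ (x.cast : ZMod p) = -b) : IsUnit x := by
  apply isUnit_of_castHom_ne_zero (by omega)
  rw [ZMod.castHom_apply]
  rcases hx with h | h <;> simp [h, hb]

theorem numRamifiedSums_pos [Fact p.Prime] (b : ℤ) : 0 < numRamifiedSums b p (t + 1) := by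
  have : NeZero (p ^ (t + 1)) := ⟨pow_ne_zero _ (Fact.out : p.Prime).ne_zero⟩
  rw [numRamifiedSums, Set.ncard_pos]
  refine Set.Nonempty.image _ ⟨b, Or.inl ?_⟩
  exact map_intCast (ZMod.castHom (dvd_pow_self p (show t + 1 ≠ 0 by omega)) (ZMod p)) b

/-- Modulo a prime the only sums with `x ≡ ±b` are `2 b` and `-2 b`. -/
theorem numRamifiedSums_one [Fact p.Prime] (hp2 : p ≠ 2) {b : ℤ} (hb : (b : ZMod p) ≠ 0) :
    numRamifiedSums b p 1 = 2 := by
  have hp : p.Prime := Fact.out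
  have hinj : Function.Injective (ZMod.castHom (dvd_pow_self p one_ne_zero) (ZMod p)) := by
    have : NeZero (p ^ 1) := ⟨pow_ne_zero _ hp.ne_zero⟩
    have : NeZero p := ⟨hp.ne_zero⟩
    refine ((Fintype.bijective_iff_surjective_and_card _).2 ⟨ZMod.castHom_surjective _, ?_⟩).1
    simp [ZMod.card]
  have hset : {x : ZMod (p ^ 1) | (x.cast : ZMod p) = b ∨ (x.cast : ZMod p) = -b} =
      {(b : ZMod (p ^ 1)), -(b : ZMod (p ^ 1))} := by
    ext x
    simp only [Set.mem_insert_iff, Set.mem_singleton_iff, Set.mem_ofPred_eq]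
    rw [← hinj.eq_iff, ← hinj.eq_iff (b := -(b : ZMod (p ^ 1)))]
    simp
  have hv : ∀ x : ZMod (p ^ 1), (x = (b : ZMod (p ^ 1)) ∨ x = -(b : ZMod (p ^ 1))) →
      hyperbolaSum ((b : ZMod (p ^ 1)) ^ 2) x = 2 * x := by
    intro x hx
    have hxu : IsUnit x := isUnit_of_cast_eq (t := 0) hb (by
      have : x ∈ ({(b : ZMod (p ^ 1)), -(b : ZMod (p ^ 1))} : Set _) := hx
      rw [← hset] at this; exact this)
    apply hxu.mul_left_cancel
    rw [mul_hyperbolaSum hxu]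
    rcases hx with rfl | rfl <;> ring
  rw [numRamifiedSums, hset, Set.image_pair, hv _ (Or.inl rfl), hv _ (Or.inr rfl),
    Set.ncard_pair]
  intro h
  have h4 : (4 : ZMod p) * b = 0 := by
    have := congrArg (ZMod.castHom (dvd_pow_self p one_ne_zero) (ZMod p)) h
    simp only [map_mul, map_neg, map_intCast, map_ofNat] at this
    linear_combination this
  rcases mul_eq_zero.1 h4 with h | h
  · have := (ZMod.natCast_eq_zero_iff 4 p).1 (by exact_mod_cast h)
    have := hp.dvd_of_dvd_pow (show p ∣ 2 ^ 2 from this)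
    exact hp2 ((Nat.prime_dvd_prime_iff_eq hp Nat.prime_two).1 this)
  · exact hb h

/-- For `x ≡ ±b` modulo `p`, the identity `x (x + b ^ 2 / x ∓ 2 b) = (x ∓ b) ^ 2` forces the sum to
be `±2 b` modulo `p ^ 2`. -/
theorem numRamifiedSums_le [Fact p.Prime] {b : ℤ} (hb : (b : ZMod p) ≠ 0) :
    numRamifiedSums b p (t + 2) ≤ 2 * p ^ t := by
  have hp : p.Prime := Fact.out
  have : NeZero (p ^ (t + 2)) := ⟨pow_ne_zero _ hp.ne_zero⟩
  have : NeZero (p ^ 2) := ⟨pow_ne_zero _ hp.ne_zero⟩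
  have h2 : p ^ 2 ∣ p ^ (t + 2) := pow_dvd_pow p (by omega)
  set ρ := ZMod.castHom h2 (ZMod (p ^ 2)) with hρ
  set π := ZMod.castHom (dvd_pow_self p (show t + 2 ≠ 0 by omega)) (ZMod p) with hπ
  have hker : ∀ d, π d = 0 → ρ d ^ 2 = 0 := by
    intro d hd
    rw [← ZMod.natCast_zmod_val d, map_natCast, ZMod.natCast_eq_zero_iff] at hd
    rw [← ZMod.natCast_zmod_val d, map_natCast, ← Nat.cast_pow, ZMod.natCast_eq_zero_iff]
    exact pow_dvd_pow_of_dvd hd 2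
  have hsub : hyperbolaSum ((b : ZMod (p ^ (t + 2))) ^ 2) ''
      {x | (x.cast : ZMod p) = b ∨ (x.cast : ZMod p) = -b} ⊆
      ρ ⁻¹' {2 * (b : ZMod (p ^ 2)), -(2 * (b : ZMod (p ^ 2)))} := by
    rintro _ ⟨x, hx, rfl⟩
    have hxu : IsUnit x := isUnit_of_cast_eq (t := t + 1) hb hx
    have hm := congrArg ρ (mul_hyperbolaSum (c := (b : ZMod (p ^ (t + 2))) ^ 2) hxu)
    simp only [map_mul, map_add, map_pow, map_intCast] at hm
    rcases hx with hx | hx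
    · have h0 := hker (x - b) (by rw [map_sub, map_intCast, hπ, ZMod.castHom_apply, hx, sub_self])
      rw [map_sub, map_intCast] at h0
      left
      apply (hxu.map ρ).mul_left_cancel
      rw [hm]
      linear_combination h0
    · have h0 := hker (x + b) (by
        rw [map_add, map_intCast, hπ, ZMod.castHom_apply, hx, neg_add_cancel])
      rw [map_add, map_intCast] at h0
      right
      apply (hxu.map ρ).mul_left_cancel
      rw [hm]
      linear_combination h0
  refine (Set.ncard_le_ncard hsub).trans ?_
  have h := ncard_preimage_castHom h2 (pow_add p t 2)
    {2 * (b : ZMod (p ^ 2)), -(2 * (b : ZMod (p ^ 2)))}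
  have hle := Set.ncard_insert_le (2 * (b : ZMod (p ^ 2))) {-(2 * (b : ZMod (p ^ 2)))}
  rw [Set.ncard_singleton] at hle
  rw [h]
  exact Nat.mul_le_mul_right _ hle

/-- The sums at `x = b + 3 (1 + 3 z)`, `0 ≤ z < 3 ^ t`, are distinct: for two such `x`, `x'` the
difference `x x' - b ^ 2` is `3` times a unit. -/
theorem pow_le_numRamifiedSums_three {b : ℤ} (hb : (b : ZMod 3) ≠ 0) :
    3 ^ t ≤ numRamifiedSums b 3 (t + 3) := by
  have : NeZero (3 ^ (t + 3)) := ⟨pow_ne_zero _ (by norm_num)⟩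
  have h2 : (2 : ZMod 3) ≠ 0 := by decide
  have : Fact (Nat.Prime 3) := ⟨Nat.prime_three⟩
  set π := ZMod.castHom (dvd_pow_self 3 (show t + 3 ≠ 0 by omega)) (ZMod 3) with hπ
  have hunit := isUnit_of_castHom_ne_zero (p := 3) (t := t + 3) (by omega)
  have h3 : π 3 = 0 := by
    rw [map_ofNat]; rfl
  set x : ℕ → ZMod (3 ^ (t + 3)) := fun z => b + 3 * (1 + 3 * z) with hx
  have hπx : ∀ z, π (x z) = b := fun z => by simp [hx, h3]
  have hinj : Set.InjOn (fun z => hyperbolaSum ((b : ZMod (3 ^ (t + 3))) ^ 2) (x z))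
      (Finset.range (3 ^ t) : Set ℕ) := by
    intro z hz w hw h
    have h := (hyperbolaSum_eq_iff (π := π) hunit (by rw [hπx]; exact hb)
      (by rw [hπx]; exact hb)).1 h
    have hu : IsUnit (b * (2 + 3 * z + 3 * w) + 3 * (1 + 3 * z) * (1 + 3 * w) :
        ZMod (3 ^ (t + 3))) := by
      apply hunit
      have e : (ZMod.castHom (dvd_pow_self 3 (show t + 3 ≠ 0 by omega)) (ZMod 3))
          (b * (2 + 3 * z + 3 * w) + 3 * (1 + 3 * z) * (1 + 3 * w)) = b * 2 := by
        rw [← hπ]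
        simp only [map_add, map_mul, h3, map_intCast, map_one, zero_mul, add_zero]
        rw [map_ofNat]
      rw [e]
      exact mul_ne_zero hb h2
    have h' : (27 * ((z : ZMod (3 ^ (t + 3))) - w)) *
      (b * (2 + 3 * z + 3 * w) + 3 * (1 + 3 * z) * (1 + 3 * w)) = 0 := by
      simp only [hx] at h
      linear_combination h
    have h27 := hu.mul_left_eq_zero.1 h'
    have hc : (((27 * z : ℕ) : ZMod (3 ^ (t + 3)))) = ((27 * w : ℕ) : ZMod (3 ^ (t + 3))) := by
      push_cast
      linear_combination h27
    rw [ZMod.natCast_eq_natCast_iff', Nat.mod_eq_of_lt, Nat.mod_eq_of_lt] at hc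
    · omega
    · rw [Finset.mem_coe, Finset.mem_range] at hw
      rw [pow_add]; omega
    · rw [Finset.mem_coe, Finset.mem_range] at hz
      rw [pow_add]; omega
  have hcard := hinj.ncard_image
  rw [Set.ncard_coe_finset, Finset.card_range] at hcard
  rw [← hcard, numRamifiedSums]
  refine Set.ncard_le_ncard ?_ (Set.toFinite _)
  rintro _ ⟨z, -, rfl⟩
  exact ⟨x z, Or.inl (hπx z), rfl⟩

end PrimePower

/-! ### The ratio of sums to differences at a prime `p ≡ 3 (mod 4)` -/

section LocalRatio

variable {p t : ℕ} {b : ℤ}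

theorem not_isSquare_neg_sq [Fact p.Prime] (hp : p % 4 = 3) (hb : (b : ZMod p) ≠ 0) :
    ¬ IsSquare ((-b ^ 2 : ℤ) : ZMod p) := by
  rintro ⟨r, hr⟩
  push_cast at hr
  have : IsSquare (-1 : ZMod p) := ⟨r / b, by field_simp; linear_combination hr⟩
  exact ZMod.exists_sq_eq_neg_one_iff.1 this hp

theorem numHyperbolaSums_neg_sq [Fact p.Prime] (hp : p % 4 = 3) (hb : (b : ZMod p) ≠ 0) :
    (2 * numHyperbolaSums (-b ^ 2) (p ^ (t + 1)) : ℝ) = (p - 1) * p ^ t := by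
  have h := two_mul_numHyperbolaSums_of_not_isSquare (t := t) (not_isSquare_neg_sq hp hb)
  have h1 : 1 ≤ p := by omega
  have := congrArg (Nat.cast : ℕ → ℝ) h
  push_cast [Nat.cast_sub h1] at this
  exact this

theorem numHyperbolaSums_sq [Fact p.Prime] (hp : p % 4 = 3) (hb : (b : ZMod p) ≠ 0) :
    (2 * numHyperbolaSums (b ^ 2) (p ^ (t + 1)) : ℝ) =
      (p - 3) * p ^ t + 2 * numRamifiedSums b p (t + 1) := by
  have h := two_mul_numHyperbolaSums_sq (t := t) (by omega) hb
  have h1 : 3 ≤ p := by omega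
  have := congrArg (Nat.cast : ℕ → ℝ) h
  push_cast [Nat.cast_sub h1] at this
  exact this

theorem numHyperbolaSums_div_eq [Fact p.Prime] (hp : p % 4 = 3) (hb : (b : ZMod p) ≠ 0) :
    (numHyperbolaSums (b ^ 2) (p ^ (t + 1)) : ℝ) / numHyperbolaSums (-b ^ 2) (p ^ (t + 1)) =
      (p - 3) / (p - 1) + 2 * (numRamifiedSums b p (t + 1) / p ^ t) / (p - 1) := by
  have h3 : (3 : ℝ) ≤ p := by exact_mod_cast (show 3 ≤ p by omega)
  have h1 : (p : ℝ) - 1 ≠ 0 := by linarith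
  have h2 : (p : ℝ) ^ t ≠ 0 := by positivity
  rw [← mul_div_mul_left _ _ (two_ne_zero (α := ℝ)), numHyperbolaSums_sq hp hb,
    numHyperbolaSums_neg_sq hp hb]
  field_simp

theorem abs_ratio_prime_sub_le [Fact p.Prime] (hp : p % 4 = 3) (hb : (b : ZMod p) ≠ 0) :
    |(numHyperbolaSums (b ^ 2) p : ℝ) / numHyperbolaSums (-b ^ 2) p - (1 + 2 / p)| ≤
      8 / (p : ℝ) ^ 2 := by
  have h3 : (3 : ℝ) ≤ p := by exact_mod_cast (show 3 ≤ p by omega)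
  have h := numHyperbolaSums_div_eq (t := 0) hp hb
  rw [zero_add, pow_one, numRamifiedSums_one (by omega) hb] at h
  rw [h]
  have h1 : (p : ℝ) - 1 ≠ 0 := by linarith
  have e : ((p : ℝ) - 3) / (p - 1) + 2 * ((2 : ℕ) / p ^ 0) / (p - 1) - (1 + 2 / p) =
      2 / (p * (p - 1)) := by
    push_cast
    field_simp
    ring
  have hpos : (0 : ℝ) < p * (p - 1) := by nlinarith
  rw [e, abs_of_nonneg (by positivity), div_le_div_iff₀ hpos (by positivity)]
  nlinarith

/-- For higher powers only the classes `x ≡ ±b` contribute to the discrepancy from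
`(p - 3) / (p - 1)`, and they contribute `O(1 / p ^ 2)`. -/
theorem abs_ratio_prime_pow_sub_le [Fact p.Prime] (hp : p % 4 = 3) (hb : (b : ZMod p) ≠ 0) :
    |(numHyperbolaSums (b ^ 2) (p ^ (t + 2)) : ℝ) / numHyperbolaSums (-b ^ 2) (p ^ (t + 2)) -
      (1 - 2 / p)| ≤ 8 / (p : ℝ) ^ 2 := by
  have h3 : (3 : ℝ) ≤ p := by exact_mod_cast (show 3 ≤ p by omega)
  rw [numHyperbolaSums_div_eq (t := t + 1) hp hb, show t + 1 + 1 = t + 2 from rfl]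
  have h1 : (0 : ℝ) < (p : ℝ) - 1 := by linarith
  have hpos : (0 : ℝ) < p * (p - 1) := by nlinarith
  have hQ : (numRamifiedSums b p (t + 2) : ℝ) / p ^ (t + 1) ≤ 2 / p := by
    rw [div_le_div_iff₀ (by positivity) (by positivity), pow_succ, ← mul_assoc]
    gcongr
    exact_mod_cast numRamifiedSums_le hb
  have hQ0 : (0 : ℝ) ≤ (numRamifiedSums b p (t + 2) : ℝ) / p ^ (t + 1) := by positivity
  have e : ((p : ℝ) - 3) / (p - 1) = 1 - 2 / p - 2 / (p * (p - 1)) := by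
    field_simp
    ring
  have hle : 2 * ((numRamifiedSums b p (t + 2) : ℝ) / p ^ (t + 1)) / (p - 1) ≤
      4 / (p * (p - 1)) := by
    have : (4 : ℝ) / (p * (p - 1)) = 2 * (2 / p) / (p - 1) := by field_simp; norm_num
    rw [this]
    gcongr
  have h0 : 0 ≤ 2 * ((numRamifiedSums b p (t + 2) : ℝ) / p ^ (t + 1)) / (p - 1) := by positivity
  have h8 : 4 / ((p : ℝ) * (p - 1)) ≤ 8 / (p : ℝ) ^ 2 := by
    rw [div_le_div_iff₀ hpos (by positivity)]
    nlinarith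
  have h2 : 2 / ((p : ℝ) * (p - 1)) ≤ 4 / (p * (p - 1)) := by gcongr; norm_num
  have h9 : 0 ≤ 2 / ((p : ℝ) * (p - 1)) := by positivity
  rw [e, abs_le]
  constructor <;> linarith

/-- The ratio at a higher prime power is bounded below uniformly in the exponent. For `p = 3` the
main term `(p - 3) / (p - 1)` vanishes and the classes `x ≡ ±b` give the bound. -/
theorem one_div_nine_le_ratio_prime_pow [Fact p.Prime] (hp : p % 4 = 3)
    (hb : (b : ZMod p) ≠ 0) :
    1 / 9 ≤ (numHyperbolaSums (b ^ 2) (p ^ (t + 2)) : ℝ) /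
      numHyperbolaSums (-b ^ 2) (p ^ (t + 2)) := by
  rw [numHyperbolaSums_div_eq (t := t + 1) hp hb, show t + 1 + 1 = t + 2 from rfl]
  by_cases h7 : 7 ≤ p
  · have h7' : (7 : ℝ) ≤ p := by exact_mod_cast h7
    have h1 : (0 : ℝ) < (p : ℝ) - 1 := by linarith
    have h0 : 0 ≤ 2 * ((numRamifiedSums b p (t + 2) : ℝ) / p ^ (t + 1)) / (p - 1) := by
      positivity
    have : 1 / 9 ≤ ((p : ℝ) - 3) / (p - 1) := by
      rw [le_div_iff₀ h1]; linarith
    linarith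
  -- the only prime below `7` that is `3` modulo `4`
  · obtain rfl : p = 3 := by omega
    have hQ : 3 ^ t ≤ 3 * numRamifiedSums b 3 (t + 2) := by
      cases t with
      | zero =>
        have h : 0 < numRamifiedSums b 3 2 := numRamifiedSums_pos b
        rw [zero_add, pow_zero]
        omega
      | succ t =>
        have := pow_le_numRamifiedSums_three (t := t) hb
        rw [show t + 1 + 2 = t + 3 from rfl]
        rw [pow_succ]
        omega
    have hQ' : (3 : ℝ) ^ t ≤ 3 * numRamifiedSums b 3 (t + 2) := by exact_mod_cast hQ
    have : (1 : ℝ) / 9 ≤ numRamifiedSums b 3 (t + 2) / 3 ^ (t + 1) := by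
      rw [div_le_div_iff₀ (by norm_num) (by positivity), pow_succ]
      linarith
    push_cast
    norm_num
    linarith

theorem one_le_ratio_prime [Fact p.Prime] (hp : p % 4 = 3) (hb : (b : ZMod p) ≠ 0) :
    1 ≤ (numHyperbolaSums (b ^ 2) p : ℝ) / numHyperbolaSums (-b ^ 2) p := by
  have h3 : (3 : ℝ) ≤ p := by exact_mod_cast (show 3 ≤ p by omega)
  have h := numHyperbolaSums_div_eq (t := 0) hp hb
  rw [zero_add, pow_one, numRamifiedSums_one (by omega) hb] at h
  rw [h, ← add_div, le_div_iff₀ (by linarith)]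
  rw [pow_zero, Nat.cast_ofNat]
  linarith

end LocalRatio

/-! ### Abel summation -/

/-- Abel's inequality. -/
theorem abs_sum_range_mul_le {f z : ℕ → ℝ} {b : ℝ} (hf : Antitone f) (hf0 : ∀ i, 0 ≤ f i)
    (hz : ∀ n, |∑ i ∈ Finset.range n, z i| ≤ b) (n : ℕ) :
    |∑ i ∈ Finset.range n, f i * z i| ≤ b * f 0 := by
  have hb : 0 ≤ b := (abs_nonneg _).trans (hz 0)
  rcases Nat.eq_zero_or_pos n with rfl | hn
  · simpa using mul_nonneg hb (hf0 0)
  have h := Finset.sum_range_by_parts f z n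
  simp only [smul_eq_mul] at h
  rw [h]
  have h1 : |f (n - 1) * ∑ i ∈ Finset.range n, z i| ≤ f (n - 1) * b := by
    rw [abs_mul, abs_of_nonneg (hf0 _)]
    exact mul_le_mul_of_nonneg_left (hz n) (hf0 _)
  have h2 : |∑ i ∈ Finset.range (n - 1),
      (f (i + 1) - f i) * ∑ j ∈ Finset.range (i + 1), z j| ≤ (f 0 - f (n - 1)) * b := by
    rw [← Finset.sum_range_sub', Finset.sum_mul]
    refine (Finset.abs_sum_le_sum_abs _ _).trans (Finset.sum_le_sum fun i _ => ?_)
    rw [abs_mul, abs_sub_comm, abs_of_nonneg (sub_nonneg.2 (hf (Nat.le_succ i)))]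
    exact mul_le_mul_of_nonneg_left (hz _) (sub_nonneg.2 (hf (Nat.le_succ i)))
  calc _ ≤ _ := abs_sub _ _
    _ ≤ _ := add_le_add h1 h2
    _ = _ := by ring

/-! ### Mertens' first theorem -/

open ArithmeticFunction in
/-- Legendre's formula for `log N!`, obtained by summing `Λ * 1 = log`. -/
theorem sum_vonMangoldt_mul_div (N : ℕ) :
    ∑ n ∈ Finset.Ioc 0 N, Λ n * ((N / n : ℕ) : ℝ) = Real.log N.factorial := by
  rw [← sum_Ioc_mul_zeta_eq_sum, vonMangoldt_mul_zeta]
  induction N with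
  | zero => simp
  | succ N ih =>
    rw [Finset.sum_Ioc_succ_top (by omega), ih, Nat.factorial_succ, Nat.cast_mul,
      Real.log_mul (by positivity) (by positivity), log_apply, add_comm]

theorem log_factorial_ge (N : ℕ) : N * Real.log N - N ≤ Real.log N.factorial := by
  rcases Nat.eq_zero_or_pos N with rfl | hN
  · simp
  have h : (N : ℝ) ^ N / N.factorial ≤ Real.exp N :=
    Real.pow_div_factorial_le_exp _ (by positivity) _
  have hf : (0 : ℝ) < N.factorial := by positivity
  have hN' : (0 : ℝ) < N := by exact_mod_cast hN
  have := Real.log_le_log (by positivity) h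
  rw [Real.log_exp, Real.log_div (by positivity) (by positivity), Real.log_pow] at this
  linarith

theorem log_factorial_le (N : ℕ) : Real.log N.factorial ≤ N * Real.log N := by
  rw [← Real.log_pow]
  exact Real.log_le_log (by positivity) (by exact_mod_cast Nat.factorial_le_pow N)

theorem sum_vonMangoldt_le (N : ℕ) :
    ∑ n ∈ Finset.Ioc 0 N, ArithmeticFunction.vonMangoldt n ≤ (Real.log 4 + 4) * N := by
  have := Chebyshev.psi_le_const_mul_self (x := N) (by positivity)
  simpa [Chebyshev.psi] using this

theorem exists_abs_sum_vonMangoldt_div_sub_log_le :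
    ∃ C : ℝ, ∀ N : ℕ, 1 ≤ N →
      |∑ n ∈ Finset.Ioc 0 N, ArithmeticFunction.vonMangoldt n / n - Real.log N| ≤ C := by
  refine ⟨Real.log 4 + 4, fun N hN => ?_⟩
  have hN' : (0 : ℝ) < N := by exact_mod_cast hN
  have h4 : 0 ≤ Real.log 4 := Real.log_nonneg (by norm_num)
  have h1 := sum_vonMangoldt_mul_div N
  have hlow : Real.log N.factorial ≤
      N * ∑ n ∈ Finset.Ioc 0 N, ArithmeticFunction.vonMangoldt n / n := by
    rw [← h1, Finset.mul_sum]
    refine Finset.sum_le_sum fun n _ => ?_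
    rw [← mul_div_assoc, mul_comm (N : ℝ), mul_div_assoc]
    exact mul_le_mul_of_nonneg_left Nat.cast_div_le ArithmeticFunction.vonMangoldt_nonneg
  have hup : N * ∑ n ∈ Finset.Ioc 0 N, ArithmeticFunction.vonMangoldt n / n ≤
      Real.log N.factorial + (Real.log 4 + 4) * N := by
    refine le_trans ?_ (add_le_add_right (sum_vonMangoldt_le N) _)
    rw [← h1, Finset.mul_sum, ← Finset.sum_add_distrib]
    refine Finset.sum_le_sum fun n hn => ?_
    rw [← mul_div_assoc, mul_comm (N : ℝ), mul_div_assoc]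
    have : (N : ℝ) / n ≤ (N / n : ℕ) + 1 := by
      rw [← Nat.floor_div_eq_div (K := ℝ)]
      exact (Nat.lt_floor_add_one _).le
    nlinarith [ArithmeticFunction.vonMangoldt_nonneg (n := n)]
  have hl := log_factorial_ge N
  have hu := log_factorial_le N
  rw [abs_le]
  constructor
  · have : N * (Real.log N - 1) ≤
      N * ∑ n ∈ Finset.Ioc 0 N, ArithmeticFunction.vonMangoldt n / n := by linarith
    have := le_of_mul_le_mul_left this hN'
    linarith
  · have : N * ∑ n ∈ Finset.Ioc 0 N, ArithmeticFunction.vonMangoldt n / n ≤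
      N * (Real.log N + (Real.log 4 + 4)) := by linarith
    have := le_of_mul_le_mul_left this hN'
    linarith

/-! ### The character modulo 4 -/

/-- The nontrivial Dirichlet character modulo `4` with real values. -/
def chiFour (n : ℕ) : ℝ := (ZMod.χ₄ n : ℤ)

theorem chiFour_mul (m n : ℕ) : chiFour (m * n) = chiFour m * chiFour n := by
  simp only [chiFour, Nat.cast_mul, map_mul, Int.cast_mul]

theorem chiFour_eq (n : ℕ) :
    chiFour n = if n % 2 = 0 then 0 else if n % 4 = 1 then 1 else -1 := by
  rw [chiFour, ZMod.χ₄_nat_eq_if_mod_four]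
  split_ifs <;> simp

theorem abs_chiFour_le (n : ℕ) : |chiFour n| ≤ 1 := by
  rw [chiFour_eq]
  split_ifs <;> simp

theorem sum_range_chiFour (n : ℕ) :
    ∑ i ∈ Finset.range n, chiFour i = if n % 4 = 2 ∨ n % 4 = 3 then 1 else 0 := by
  induction n with
  | zero => simp
  | succ n ih =>
    rw [Finset.sum_range_succ, ih, chiFour_eq]
    have : n % 4 = 0 ∨ n % 4 = 1 ∨ n % 4 = 2 ∨ n % 4 = 3 := by omega
    rcases this with h | h | h | h
    · rw [if_neg (by omega), if_pos (by omega), if_neg (by omega)]; norm_num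
    · rw [if_neg (by omega), if_neg (by omega), if_pos h, if_pos (by omega)]; norm_num
    · rw [if_pos (by omega), if_pos (by omega), if_pos (by omega)]; norm_num
    · rw [if_pos (by omega), if_neg (by omega), if_neg (by omega), if_neg (by omega)]; norm_num

theorem abs_sum_chiFour_shift_le (m n : ℕ) :
    |∑ i ∈ Finset.range n, chiFour (m + i)| ≤ 1 := by
  have h := Finset.sum_range_add chiFour m n
  have : ∑ i ∈ Finset.range n, chiFour (m + i) =
      ∑ i ∈ Finset.range (m + n), chiFour i - ∑ i ∈ Finset.range m, chiFour i := by
    rw [h]; ring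
  rw [this, sum_range_chiFour, sum_range_chiFour]
  split_ifs <;> norm_num

/-- Tails of a series `∑ χ(n) f(n)` with `f` decreasing are bounded by the first weight. -/
theorem abs_sum_Ioc_chiFour_mul_le {f : ℕ → ℝ} {m n : ℕ} (hmn : m ≤ n)
    (hf : ∀ i j, m < i → i ≤ j → f j ≤ f i) (hf0 : ∀ i, 0 ≤ f i) :
    |∑ i ∈ Finset.Ioc m n, chiFour i * f i| ≤ f (m + 1) := by
  have h := abs_sum_range_mul_le (f := fun i => f (m + 1 + i)) (z := fun i => chiFour (m + 1 + i))
    (b := 1) (fun i j hij => hf _ _ (by omega) (by omega)) (fun i => hf0 _)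
    (abs_sum_chiFour_shift_le (m + 1)) (n - m)
  rw [one_mul, add_zero] at h
  have e : Finset.Ioc m n = Finset.Ico (m + 1) (n + 1) := by ext; simp
  rw [e, Finset.sum_Ico_eq_sum_range]
  simp only [mul_comm (chiFour _)]
  rwa [show n + 1 - (m + 1) = n - m by omega]

/-- The partial sums of `∑ χ(n) / n` converge to a positive number, with error at most the first
omitted weight. -/
theorem exists_pos_abs_sum_chiFour_div_sub_le :
    ∃ L : ℝ, 0 < L ∧ ∀ M : ℕ, |∑ n ∈ Finset.Ioc 0 M, chiFour n / n - L| ≤ 1 / (M + 1) := by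
  have key : ∀ m n : ℕ, m ≤ n → |∑ i ∈ Finset.Ioc 0 n, chiFour i / i -
      ∑ i ∈ Finset.Ioc 0 m, chiFour i / i| ≤ 1 / ((m : ℝ) + 1) := by
    intro m n hmn
    have h := abs_sum_Ioc_chiFour_mul_le (f := fun i => ((i : ℝ))⁻¹) hmn
      (fun i j hi hij => by
        have : (0 : ℝ) < i := by exact_mod_cast (by omega : 0 < i)
        have : (i : ℝ) ≤ j := by exact_mod_cast hij
        gcongr) (fun i => by positivity)
    rw [← Finset.sum_Ioc_consecutive _ (Nat.zero_le m) hmn, add_sub_cancel_left]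
    simpa [div_eq_mul_inv] using h
  have hc : CauchySeq fun n : ℕ => ∑ i ∈ Finset.Ioc 0 n, chiFour i / i := by
    refine cauchySeq_of_le_tendsto_0 (fun n : ℕ => 2 * (1 / ((n : ℝ) + 1))) ?_ ?_
    · intro n m N hn hm
      have h1 := key N n hn
      have h2 := key N m hm
      rw [Real.dist_eq]
      rw [abs_le] at *
      constructor <;> linarith
    · simpa using (tendsto_one_div_add_atTop_nhds_zero_nat (𝕜 := ℝ)).const_mul 2
  obtain ⟨L, hL⟩ := cauchySeq_tendsto_of_complete hc
  have hlim : ∀ M : ℕ, |∑ n ∈ Finset.Ioc 0 M, chiFour n / n - L| ≤ 1 / ((M : ℝ) + 1) := by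
    intro M
    rw [abs_sub_comm]
    refine le_of_tendsto ((hL.sub_const _).abs) ?_
    filter_upwards [Filter.eventually_ge_atTop M] with n hn
    exact key M n hn
  refine ⟨L, ?_, hlim⟩
  have h := hlim 2
  have e : ∑ n ∈ Finset.Ioc 0 2, chiFour n / n = 1 := by
    rw [show Finset.Ioc 0 2 = {1, 2} from rfl, Finset.sum_pair (by norm_num), chiFour_eq,
      chiFour_eq]
    norm_num
  rw [e, abs_le] at h
  norm_num at h
  linarith [h.2]

theorem exists_abs_sum_chiFour_mul_log_div_le :
    ∃ C : ℝ, ∀ N : ℕ, |∑ n ∈ Finset.Ioc 0 N, chiFour n * (Real.log n / n)| ≤ C := by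
  refine ⟨|∑ n ∈ Finset.Ioc 0 2, chiFour n * (Real.log n / n)| + Real.log 3 / 3 + 2, fun N => ?_⟩
  have h3 : 0 ≤ Real.log 3 / 3 := div_nonneg (Real.log_nonneg (by norm_num)) (by norm_num)
  rcases le_or_gt 2 N with h | h
  · rw [← Finset.sum_Ioc_consecutive _ (Nat.zero_le 2) h]
    refine (abs_add_le _ _).trans ?_
    have := abs_sum_Ioc_chiFour_mul_le (f := fun i => Real.log i / i) h ?_
      (fun i => div_nonneg (Real.log_natCast_nonneg _) (Nat.cast_nonneg _))
    · norm_num at this ⊢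
      linarith
    · intro i j hi hij
      have hi3 : (3 : ℝ) ≤ i := by exact_mod_cast hi
      have hij' : (i : ℝ) ≤ j := by exact_mod_cast hij
      have he := Real.exp_one_lt_d9
      exact Real.log_div_self_antitoneOn (Set.mem_ofPred.2 (by linarith))
        (Set.mem_ofPred.2 (by linarith)) hij'
  · have : ∑ n ∈ Finset.Ioc 0 N, chiFour n * (Real.log n / n) = 0 := by
      refine Finset.sum_eq_zero fun n hn => ?_
      obtain rfl : n = 1 := by
        rw [Finset.mem_Ioc] at hn; omega
      simp
    rw [this, abs_zero]
    positivity

open ArithmeticFunction in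
/-- Expanding `log = Λ * 1` in `∑ χ(n) log n / n` shows that `L(1, χ) ∑ χ(n) Λ(n) / n` is bounded;
as `L(1, χ) ≠ 0`, so is `∑ χ(n) Λ(n) / n`. -/
theorem exists_abs_sum_chiFour_mul_vonMangoldt_div_le :
    ∃ C : ℝ, ∀ N : ℕ, |∑ n ∈ Finset.Ioc 0 N, chiFour n * Λ n / n| ≤ C := by
  obtain ⟨L, hL, hG⟩ := exists_pos_abs_sum_chiFour_div_sub_le
  obtain ⟨C, hC⟩ := exists_abs_sum_chiFour_mul_log_div_le
  refine ⟨(C + (Real.log 4 + 4)) / L, fun N => ?_⟩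
  have h4 : 0 ≤ Real.log 4 := Real.log_nonneg (by norm_num)
  let F : ArithmeticFunction ℝ := ⟨fun n => chiFour n * Λ n / n, by simp⟩
  let G : ArithmeticFunction ℝ := ⟨fun n => chiFour n / n, by simp⟩
  have hFG : ∀ n, (F * G) n = chiFour n * (Real.log n / n) := by
    intro n
    have hdiv := Nat.sum_divisorsAntidiagonal (n := n) (fun i _ => Λ i)
    rw [← vonMangoldt_sum, mul_apply, ← hdiv, Finset.sum_div, Finset.mul_sum]
    refine Finset.sum_congr rfl fun x hx => ?_
    obtain ⟨hx, -⟩ := Nat.mem_divisorsAntidiagonal.1 hx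
    simp only [F, G, coe_mk]
    rw [← hx, chiFour_mul, Nat.cast_mul]
    rw [div_mul_div_comm]
    ring
  have hsum := sum_Ioc_mul_eq_sum_sum F G N
  simp only [hFG] at hsum
  have herr : |∑ n ∈ Finset.Ioc 0 N, F n * ∑ m ∈ Finset.Ioc 0 (N / n), G m -
      L * ∑ n ∈ Finset.Ioc 0 N, F n| ≤ Real.log 4 + 4 := by
    rcases Nat.eq_zero_or_pos N with rfl | hN
    · simpa using by linarith
    have hN' : (0 : ℝ) < N := by exact_mod_cast hN
    rw [Finset.mul_sum, ← Finset.sum_sub_distrib]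
    refine (Finset.abs_sum_le_sum_abs _ _).trans ?_
    have : ∑ n ∈ Finset.Ioc 0 N, Λ n / N ≤ Real.log 4 + 4 := by
      rw [← Finset.sum_div, div_le_iff₀ hN']
      exact sum_vonMangoldt_le N
    refine le_trans (Finset.sum_le_sum fun n hn => ?_) this
    rw [Finset.mem_Ioc] at hn
    have hn' : (0 : ℝ) < n := by exact_mod_cast hn.1
    rw [mul_comm L, ← mul_sub, abs_mul]
    have h1 : |F n| ≤ Λ n / n := by
      simp only [F, coe_mk]
      rw [abs_div, abs_mul, abs_of_nonneg (vonMangoldt_nonneg (n := n)), abs_of_pos hn']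
      gcongr
      nlinarith [abs_chiFour_le n, vonMangoldt_nonneg (n := n)]
    have h2 : |∑ m ∈ Finset.Ioc 0 (N / n), G m - L| ≤ n / N := by
      refine (hG (N / n)).trans ?_
      have h3 : (N : ℝ) / n ≤ (N / n : ℕ) + 1 := by
        rw [← Nat.floor_div_eq_div (K := ℝ)]
        exact (Nat.lt_floor_add_one _).le
      rw [← one_div_div (N : ℝ) (n : ℝ)]
      exact one_div_le_one_div_of_le (by positivity) h3
    calc _ ≤ Λ n / n * (n / N) := mul_le_mul h1 h2 (abs_nonneg _)
          (div_nonneg vonMangoldt_nonneg hn'.le)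
      _ = _ := by field_simp
  rw [← hsum] at herr
  have hCN := hC N
  have : |L * ∑ n ∈ Finset.Ioc 0 N, F n| ≤ C + (Real.log 4 + 4) := by
    rw [abs_le] at *
    constructor <;> linarith
  rw [abs_mul, abs_of_pos hL] at this
  rw [le_div_iff₀ hL, mul_comm]
  exact this

/-! ### Mertens' theorems for the primes congruent to 3 modulo 4 -/

/-- The primes `p ≤ N` with `p ≡ 3 (mod 4)`. -/
def primesThreeModFour (N : ℕ) : Finset ℕ :=
  (Finset.Ioc 0 N).filter fun p => p.Prime ∧ p ≡ 3 [MOD 4]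

theorem mem_primesThreeModFour {N p : ℕ} :
    p ∈ primesThreeModFour N ↔ p ≤ N ∧ p.Prime ∧ p % 4 = 3 := by
  rw [primesThreeModFour, Finset.mem_filter, Finset.mem_Ioc, Nat.ModEq]
  constructor
  · rintro ⟨⟨-, h⟩, hp, h3⟩
    exact ⟨h, hp, h3⟩
  · rintro ⟨h, hp, h3⟩
    exact ⟨⟨hp.pos, h⟩, hp, h3⟩

open ArithmeticFunction in
/-- The indicator of `3 (mod 4)` is `(1 - χ) / 2` on odd numbers; the prime `2` and the proper prime
powers contribute a bounded amount. -/
theorem exists_abs_sum_log_div_sub_half_log_le :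
    ∃ B : ℝ, ∀ N : ℕ, 1 ≤ N →
      |∑ p ∈ primesThreeModFour N, Real.log p / p - Real.log N / 2| ≤ B := by
  obtain ⟨C₁, h₁⟩ := exists_abs_sum_vonMangoldt_div_sub_log_le
  obtain ⟨C₂, h₂⟩ := exists_abs_sum_chiFour_mul_vonMangoldt_div_le
  have hs : Summable fun n : ℕ => (if n.Prime then 0 else Λ n) / n := by
    have := vonMangoldt.summable_residueClass_non_primes_div (q := 1) 0
    refine this.congr fun n => ?_
    have : (n : ZMod 1) = 0 := Subsingleton.elim _ _
    simp [vonMangoldt.residueClass, this]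
  have hs0 : ∀ n : ℕ, 0 ≤ (if n.Prime then 0 else Λ n) / (n : ℝ) := fun n => by
    refine div_nonneg ?_ (Nat.cast_nonneg n)
    split_ifs
    exacts [le_rfl, vonMangoldt_nonneg]
  refine ⟨(∑' n : ℕ, (if n.Prime then 0 else Λ n) / (n : ℝ) + 1) + (C₁ + C₂) / 2, fun N hN => ?_⟩
  rw [primesThreeModFour, Finset.sum_filter]
  have hpt : ∀ n : ℕ, |(if n.Prime ∧ n ≡ 3 [MOD 4] then Real.log n / n else 0) -
      (Λ n / n - chiFour n * Λ n / n) / 2| ≤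
      (if n.Prime then 0 else Λ n) / n + (if n = 2 then 1 else 0) := by
    intro n
    by_cases hp : n.Prime
    · rw [vonMangoldt_apply_prime hp, chiFour_eq]
      simp only [hp, true_and, if_true, zero_div, zero_add, Nat.ModEq]
      have hl := Real.log_two_lt_d9
      have hl0 := Real.log_two_gt_d9
      rcases hp.eq_two_or_odd with rfl | hodd
      · norm_num
        rw [abs_le]
        constructor <;> linarith
      · have : n % 4 = 1 ∨ n % 4 = 3 := by omega
        rw [if_neg (show ¬ n % 2 = 0 by omega), if_neg (show n ≠ 2 by omega)]
        rcases this with h | h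
        · simp [h]
        · simp only [h]
          norm_num
          ring_nf
    · simp only [hp, false_and, if_false, zero_sub, abs_neg]
      have h0 : 0 ≤ Λ n / n := div_nonneg vonMangoldt_nonneg (Nat.cast_nonneg n)
      have hχ := abs_le.1 (abs_chiFour_le n)
      have h2 : (0 : ℝ) ≤ if n = 2 then 1 else 0 := by split_ifs <;> norm_num
      rw [mul_div_assoc, abs_le]
      constructor <;> nlinarith
  have hsum : |∑ n ∈ Finset.Ioc 0 N, (if n.Prime ∧ n ≡ 3 [MOD 4] then Real.log n / n else 0) -
      (∑ n ∈ Finset.Ioc 0 N, Λ n / n - ∑ n ∈ Finset.Ioc 0 N, chiFour n * Λ n / n) / 2| ≤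
      ∑' n : ℕ, (if n.Prime then 0 else Λ n) / (n : ℝ) + 1 := by
    rw [← Finset.sum_sub_distrib, Finset.sum_div, ← Finset.sum_sub_distrib]
    refine (Finset.abs_sum_le_sum_abs _ _).trans ((Finset.sum_le_sum fun n _ => hpt n).trans ?_)
    rw [Finset.sum_add_distrib]
    refine add_le_add (hs.sum_le_tsum _ fun n _ => hs0 n) ?_
    rw [Finset.sum_ite_eq']
    split_ifs <;> norm_num
  have h₁ := h₁ N hN
  have h₂ := h₂ N
  rw [abs_le] at *
  constructor <;> linarith

/-- `(y - x) / x` approximates `log y - log x` along `x = log (i + 2)`, `y = log (i + 3)`, with an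
error dominated by the telescoping `1 / x - 1 / y`. -/
theorem abs_sum_log_ratio_sub_log_log_le (n : ℕ) :
    |∑ i ∈ Finset.range n, (Real.log ((i : ℝ) + 3) - Real.log ((i : ℝ) + 2)) /
      Real.log ((i : ℝ) + 2) -
      (Real.log (Real.log ((n : ℝ) + 2)) - Real.log (Real.log 2))| ≤ 1 / Real.log 2 := by
  have hx : ∀ i : ℕ, 0 < Real.log ((i : ℝ) + 2) := fun i =>
    Real.log_pos (by have : (0 : ℝ) ≤ i := Nat.cast_nonneg i; linarith)
  have ht : ∀ g : ℕ → ℝ, ∑ i ∈ Finset.range n, (g (i + 1) - g i) = g n - g 0 := fun g =>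
    Finset.sum_range_sub g n
  have h1 := ht fun i => Real.log (Real.log ((i : ℝ) + 2))
  have h2 := ht fun i => - (1 / Real.log ((i : ℝ) + 2))
  have e : ∀ i : ℕ, ((i + 1 : ℕ) : ℝ) + 2 = i + 3 := fun i => by push_cast; ring
  simp only [e, Nat.cast_zero, zero_add] at h1 h2
  rw [← h1, ← Finset.sum_sub_distrib]
  have hle : ∑ i ∈ Finset.range n, (-(1 / Real.log ((i : ℝ) + 3)) -
      -(1 / Real.log ((i : ℝ) + 2))) ≤ 1 / Real.log 2 := by
    rw [h2]
    have := hx n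
    have : 0 < 1 / Real.log ((n : ℝ) + 2) := by positivity
    linarith
  refine le_trans (Finset.abs_sum_le_sum_abs _ _) (le_trans (Finset.sum_le_sum fun i _ => ?_) hle)
  have hx0 := hx i
  have hy0 := hx (i + 1)
  rw [e] at hy0
  have hi : (0 : ℝ) ≤ i := Nat.cast_nonneg i
  have hxy : Real.log ((i : ℝ) + 2) ≤ Real.log ((i : ℝ) + 3) :=
    Real.log_le_log (by linarith) (by linarith)
  have hyx : Real.log ((i : ℝ) + 3) - Real.log ((i : ℝ) + 2) ≤ 1 := by
    rw [← Real.log_div (by linarith) (by linarith)]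
    refine (Real.log_le_sub_one_of_pos (by positivity)).trans ?_
    rw [sub_le_iff_le_add, div_le_iff₀ (by linarith)]
    linarith
  set x := Real.log ((i : ℝ) + 2)
  set y := Real.log ((i : ℝ) + 3)
  have hup : Real.log y - Real.log x ≤ (y - x) / x := by
    rw [← Real.log_div hy0.ne' hx0.ne']
    refine (Real.log_le_sub_one_of_pos (by positivity)).trans (le_of_eq ?_)
    field_simp
  have hlo : (y - x) / y ≤ Real.log y - Real.log x := by
    rw [← Real.log_div hy0.ne' hx0.ne']
    refine le_trans (le_of_eq ?_) (Real.one_sub_inv_le_log_of_pos (by positivity))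
    field_simp
  rw [abs_of_nonneg (by linarith)]
  have : (y - x) / x - (y - x) / y ≤ -(1 / y) - -(1 / x) := by
    have e1 : (y - x) / x - (y - x) / y = (y - x) * (1 / x - 1 / y) := by field_simp
    have e2 : 0 ≤ 1 / x - 1 / y := sub_nonneg.2 (one_div_le_one_div_of_le hx0 hxy)
    rw [e1]
    nlinarith
  linarith

theorem sum_primesThreeModFour_eq_sum_range (g : ℕ → ℝ) (n : ℕ) :
    ∑ p ∈ primesThreeModFour (n + 1), g p =
      ∑ i ∈ Finset.range n,
        if (i + 2).Prime ∧ (i + 2) ≡ 3 [MOD 4] then g (i + 2) else 0 := by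
  rw [primesThreeModFour, Finset.sum_filter, ← Finset.sum_Ioc_consecutive _ (Nat.zero_le 1)
    (show 1 ≤ n + 1 by omega)]
  have : Finset.Ioc 1 (n + 1) = Finset.Ico 2 (n + 2) := by
    ext; simp only [Finset.mem_Ioc, Finset.mem_Ico]; omega
  rw [this, Finset.sum_Ico_eq_sum_range]
  simp [Nat.not_prime_one, add_comm]

/-- Abel summation with weights `1 / log p`: the sequence `log p / p` (over `p ≡ 3`) is compared
with `(log (n + 1) - log n) / 2`, from which its partial sums differ by a bounded amount. -/
theorem exists_abs_sum_inv_sub_half_log_log_le :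
    ∃ B : ℝ, ∀ N : ℕ, 2 ≤ N →
      |∑ p ∈ primesThreeModFour N, 1 / (p : ℝ) - Real.log (Real.log N) / 2| ≤ B := by
  obtain ⟨B, hB⟩ := exists_abs_sum_log_div_sub_half_log_le
  have hl2 : 0 < Real.log 2 := Real.log_pos (by norm_num)
  have hl2' : Real.log 2 ≤ 1 := by have := Real.log_two_lt_d9; linarith
  refine ⟨(B + 1) * (1 / Real.log 2) + (1 / Real.log 2 + |Real.log (Real.log 2)|) / 2 + 1,
    fun N hN => ?_⟩
  obtain ⟨n, rfl⟩ : ∃ n, N = n + 1 := ⟨N - 1, by omega⟩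
  have hn1 : (1 : ℝ) ≤ n := by exact_mod_cast (by omega : 1 ≤ n)
  set w : ℕ → ℝ := fun i =>
    if (i + 2).Prime ∧ (i + 2) ≡ 3 [MOD 4] then Real.log ((i + 2 : ℕ) : ℝ) / (i + 2 : ℕ) else 0
    with hw
  set z : ℕ → ℝ := fun i => w i - (Real.log ((i : ℝ) + 3) - Real.log ((i : ℝ) + 2)) / 2 with hz
  have htel : ∀ m : ℕ, ∑ i ∈ Finset.range m,
      (Real.log ((i : ℝ) + 3) - Real.log ((i : ℝ) + 2)) = Real.log ((m : ℝ) + 2) - Real.log 2 := by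
    intro m
    have := Finset.sum_range_sub (fun i : ℕ => Real.log ((i : ℝ) + 2)) m
    have e : ∀ i : ℕ, ((i + 1 : ℕ) : ℝ) + 2 = i + 3 := fun i => by push_cast; ring
    simpa only [e, Nat.cast_zero, zero_add] using this
  have hzb : ∀ m, |∑ i ∈ Finset.range m, z i| ≤ B + 1 := by
    intro m
    have hm : (0 : ℝ) ≤ m := Nat.cast_nonneg m
    have h := hB (m + 1) (by omega)
    rw [sum_primesThreeModFour_eq_sum_range (fun p => Real.log p / p)] at h
    rw [hz, Finset.sum_sub_distrib, ← Finset.sum_div, htel]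
    have hd : Real.log ((m : ℝ) + 2) - Real.log ((m + 1 : ℕ) : ℝ) ≤ 1 := by
      push_cast
      rw [← Real.log_div (by linarith) (by linarith)]
      refine (Real.log_le_sub_one_of_pos (by positivity)).trans ?_
      rw [sub_le_iff_le_add, div_le_iff₀ (by linarith)]
      linarith
    have hd0 : Real.log ((m + 1 : ℕ) : ℝ) ≤ Real.log ((m : ℝ) + 2) := by
      push_cast
      exact Real.log_le_log (by linarith) (by linarith)
    rw [abs_le] at h ⊢
    constructor <;> linarith
  have hanti : Antitone fun i : ℕ => 1 / Real.log ((i : ℝ) + 2) := by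
    intro i j hij
    have hi : (0 : ℝ) ≤ i := Nat.cast_nonneg i
    have hij' : (i : ℝ) ≤ j := by exact_mod_cast hij
    exact one_div_le_one_div_of_le (Real.log_pos (by linarith))
      (Real.log_le_log (by linarith) (by linarith))
  have habel := abs_sum_range_mul_le hanti
    (fun i => by
      have hi : (0 : ℝ) ≤ i := Nat.cast_nonneg i
      exact one_div_nonneg.2 (Real.log_nonneg (by linarith))) hzb n
  have hratio := abs_sum_log_ratio_sub_log_log_le n
  have hsplit : ∑ i ∈ Finset.range n, 1 / Real.log ((i : ℝ) + 2) * z i =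
      ∑ p ∈ primesThreeModFour (n + 1), 1 / (p : ℝ) -
      (∑ i ∈ Finset.range n, (Real.log ((i : ℝ) + 3) - Real.log ((i : ℝ) + 2)) /
        Real.log ((i : ℝ) + 2)) / 2 := by
    rw [sum_primesThreeModFour_eq_sum_range (fun p => 1 / (p : ℝ)), Finset.sum_div,
      ← Finset.sum_sub_distrib]
    refine Finset.sum_congr rfl fun i _ => ?_
    have hi : (0 : ℝ) ≤ i := Nat.cast_nonneg i
    have hlog : Real.log ((i : ℝ) + 2) ≠ 0 := (Real.log_pos (by linarith)).ne'
    simp only [hz, hw]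
    split_ifs
    · push_cast
      field_simp
    · field_simp
      ring
  rw [hsplit] at habel
  have hlN : 0 < Real.log ((n + 1 : ℕ) : ℝ) := Real.log_pos (by push_cast; linarith)
  have hll : Real.log (Real.log ((n : ℝ) + 2)) - Real.log (Real.log ((n + 1 : ℕ) : ℝ)) ≤ 1 := by
    have h2 : Real.log ((n : ℝ) + 2) ≤ 2 * Real.log ((n + 1 : ℕ) : ℝ) := by
      rw [← Nat.cast_ofNat (n := 2), ← Real.log_pow]
      refine Real.log_le_log (by positivity) ?_
      push_cast
      nlinarith
    have h3 := Real.log_le_log (Real.log_pos (by linarith)) h2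
    rw [Real.log_mul (by norm_num) hlN.ne'] at h3
    linarith
  have hll0 : Real.log (Real.log ((n + 1 : ℕ) : ℝ)) ≤ Real.log (Real.log ((n : ℝ) + 2)) :=
    Real.log_le_log hlN (Real.log_le_log (by positivity) (by push_cast; linarith))
  have hc := neg_abs_le (Real.log (Real.log 2))
  have hc' := le_abs_self (Real.log (Real.log 2))
  simp only [Nat.cast_zero, zero_add] at habel
  rw [abs_le] at habel hratio ⊢
  constructor <;> linarith

/-! ### The size of the primorial -/

theorem one_le_log_three : 1 < Real.log 3 := by
  rw [Real.lt_log_iff_exp_lt (by norm_num)]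
  have := Real.exp_one_lt_d9
  linarith

theorem sum_log_primesThreeModFour_le (N : ℕ) :
    ∑ p ∈ primesThreeModFour N, Real.log p ≤ Real.log 4 * N := by
  refine le_trans ?_ (Chebyshev.theta_le_log4_mul_x (x := N) (by positivity))
  rw [Chebyshev.theta, Nat.floor_natCast]
  refine Finset.sum_le_sum_of_subset_of_nonneg ?_ fun p _ _ => Real.log_natCast_nonneg p
  intro p hp
  obtain ⟨h, hp, -⟩ := mem_primesThreeModFour.1 hp
  simp [h, hp, hp.pos]

theorem log_three_le_sum_log_primesThreeModFour {N : ℕ} (hN : 3 ≤ N) :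
    Real.log 3 ≤ ∑ p ∈ primesThreeModFour N, Real.log p := by
  have h : 3 ∈ primesThreeModFour N :=
    mem_primesThreeModFour.2 ⟨hN, Nat.prime_three, by norm_num⟩
  have := Finset.single_le_sum (f := fun p : ℕ => Real.log p)
    (fun p _ => Real.log_natCast_nonneg p) h
  simpa using this

/-- By the weighted estimate, an interval `(N / K, N]` with `K` a large constant carries
`∑ log p / p ≥ 1`, which gives a linear lower bound for `∑ log p`. -/
theorem exists_mul_le_sum_log_primesThreeModFour :
    ∃ K : ℕ, 1 ≤ K ∧ ∀ N : ℕ, 3 ≤ N →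
      (N : ℝ) / (2 * K) ≤ ∑ p ∈ primesThreeModFour N, Real.log p := by
  obtain ⟨B, hB⟩ := exists_abs_sum_log_div_sub_half_log_le
  obtain ⟨K, hK⟩ := exists_nat_ge (Real.exp (4 * B + 2))
  have hK0 : (0 : ℝ) < K := (Real.exp_pos _).trans_le hK
  have hK1 : 1 ≤ K := by
    have : 0 < K := by exact_mod_cast hK0
    exact this
  -- the choice of `K` makes `(log N - log (N / K)) / 2` exceed the two errors `B` by at least `1`
  refine ⟨K, hK1, fun N hN => ?_⟩
  rcases lt_or_ge N K with hNK | hNK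
  · refine le_trans ?_ (log_three_le_sum_log_primesThreeModFour hN)
    refine le_trans ?_ one_le_log_three.le
    rw [div_le_one (by positivity)]
    have : (N : ℝ) ≤ K := by exact_mod_cast hNK.le
    linarith
  · set M := N / K with hM
    have hM1 : 1 ≤ M := Nat.div_pos hNK hK1
    have hM0 : (0 : ℝ) < M := by exact_mod_cast hM1
    have hMN : M ≤ N := Nat.div_le_self _ _
    have hMle : (M : ℝ) * K ≤ N := by exact_mod_cast Nat.div_mul_le_self N K
    have hMge : (N : ℝ) ≤ 2 * K * M := by
      have h1 : N < K * (M + 1) := by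
        rw [hM]; exact Nat.lt_mul_div_succ N hK1
      have h2 : N ≤ 2 * K * M := by nlinarith
      exact_mod_cast h2
    have h1 := abs_le.1 (hB N (by omega))
    have h2 := abs_le.1 (hB M hM1)
    have hlog : Real.log M + (4 * B + 2) ≤ Real.log N := by
      have h3 := Real.log_le_log (by positivity) hMle
      have h4 := Real.log_le_log (Real.exp_pos _) hK
      rw [Real.log_exp] at h4
      rw [Real.log_mul hM0.ne' hK0.ne'] at h3
      linarith
    have hsub : primesThreeModFour M ⊆ primesThreeModFour N := fun p hp => by
      obtain ⟨h, hp⟩ := mem_primesThreeModFour.1 hp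
      exact mem_primesThreeModFour.2 ⟨h.trans hMN, hp⟩
    have hdiff := Finset.sum_sdiff hsub (f := fun p : ℕ => Real.log p / p)
    have h5 : 1 ≤ ∑ p ∈ primesThreeModFour N \ primesThreeModFour M, Real.log p / p := by linarith
    calc (N : ℝ) / (2 * K) ≤ M := by
          rw [div_le_iff₀ (by positivity)]; linarith
      _ ≤ M * ∑ p ∈ primesThreeModFour N \ primesThreeModFour M, Real.log p / p :=
          le_mul_of_one_le_right hM0.le h5
      _ ≤ ∑ p ∈ primesThreeModFour N \ primesThreeModFour M, Real.log p := by
          rw [Finset.mul_sum]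
          refine Finset.sum_le_sum fun p hp => ?_
          rw [Finset.mem_sdiff, mem_primesThreeModFour, mem_primesThreeModFour] at hp
          have hpM : M < p := by
            by_contra hle
            exact hp.2 ⟨by omega, hp.1.2⟩
          have hpM' : (M : ℝ) ≤ p := by exact_mod_cast hpM.le
          have hp0 : (0 : ℝ) < p := hM0.trans_le hpM'
          rw [← mul_div_assoc, div_le_iff₀ hp0, mul_comm]
          exact mul_le_mul_of_nonneg_left hpM' (Real.log_natCast_nonneg p)
      _ ≤ _ := Finset.sum_le_sum_of_subset_of_nonneg Finset.sdiff_subset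
          fun p _ _ => Real.log_natCast_nonneg p

theorem exists_log_sum_log_primesThreeModFour_bounds :
    ∃ A : ℝ, 0 < A ∧ ∀ N : ℕ, 3 ≤ N →
      0 < Real.log (∑ p ∈ primesThreeModFour N, Real.log p) ∧
      Real.log N ≤ A * Real.log (∑ p ∈ primesThreeModFour N, Real.log p) ∧
      Real.log (∑ p ∈ primesThreeModFour N, Real.log p) ≤ 2 * Real.log N := by
  obtain ⟨K, hK1, hK⟩ := exists_mul_le_sum_log_primesThreeModFour
  have hK1' : (1 : ℝ) ≤ K := by exact_mod_cast hK1
  have hε : 0 < Real.log (Real.log 3) := Real.log_pos one_le_log_three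
  have hD : 0 ≤ Real.log (2 * K) := Real.log_nonneg (by linarith)
  refine ⟨1 + Real.log (2 * K) / Real.log (Real.log 3), by positivity, fun N hN => ?_⟩
  have hN3 : (3 : ℝ) ≤ N := by exact_mod_cast hN
  have h3 := log_three_le_sum_log_primesThreeModFour hN
  have hlow := hK N hN
  have hup := sum_log_primesThreeModFour_le N
  set θ := ∑ p ∈ primesThreeModFour N, Real.log p
  have hl3 := one_le_log_three
  have hθ : 0 < θ := by linarith
  have hθε : Real.log (Real.log 3) ≤ Real.log θ := Real.log_le_log (by linarith) h3
  refine ⟨hε.trans_le hθε, ?_, ?_⟩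
  · have h := Real.log_le_log (by positivity) hlow
    rw [Real.log_div (by positivity) (by positivity)] at h
    have h' : Real.log (2 * K) ≤ Real.log (2 * K) / Real.log (Real.log 3) * Real.log θ := by
      rw [div_mul_eq_mul_div, le_div_iff₀ hε]
      exact mul_le_mul_of_nonneg_left hθε hD
    linarith
  · rw [← Nat.cast_ofNat (n := 2), ← Real.log_pow]
    refine Real.log_le_log hθ (hup.trans ?_)
    have h4 : Real.log 4 ≤ 3 := by
      have := Real.log_le_sub_one_of_pos (show (0 : ℝ) < 4 by norm_num)
      linarith
    nlinarith

/-! ### Products over the primes congruent to 3 modulo 4 -/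

/-- First-order expansion of `log`, with the two inequalities `1 - 1 / r ≤ log r ≤ r - 1`; the lower
bound on `r` controls the quadratic term `(r - 1) ^ 2 / r ≤ 9 (10 / x) ^ 2`. -/
theorem abs_log_sub_le {r x s : ℝ} (hx : 1 ≤ x) (hs : |s| = 1)
    (h : |r - (1 + s * (2 / x))| ≤ 8 / x ^ 2)
    (hr : 1 / 9 ≤ r) : |Real.log r - s * (2 / x)| ≤ 908 * (1 / x ^ 2) := by
  have hr0 : 0 < r := by linarith
  have hup := Real.log_le_sub_one_of_pos hr0
  have hlo := Real.one_sub_inv_le_log_of_pos hr0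
  have hd : |r - 1| ≤ 10 / x := by
    have e : r - 1 = (r - (1 + s * (2 / x))) + s * (2 / x) := by ring
    have e2 : |s * (2 / x)| = 2 / x := by
      rw [abs_mul, hs, one_mul, abs_of_nonneg (by positivity)]
    have e3 : 8 / x ^ 2 ≤ 8 / x := by
      gcongr
      nlinarith
    calc |r - 1| ≤ 8 / x ^ 2 + 2 / x := by
          rw [e]
          exact (abs_add_le _ _).trans (by rw [e2]; linarith)
      _ ≤ 8 / x + 2 / x := by linarith
      _ = 10 / x := by ring
  have hsq : (r - 1) ^ 2 ≤ 100 * (1 / x ^ 2) := by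
    have := sq_le_sq' (abs_le.1 hd).1 (abs_le.1 hd).2
    rw [div_pow] at this
    linarith [show (10 : ℝ) ^ 2 / x ^ 2 = 100 * (1 / x ^ 2) by ring]
  have hinv : 1 - r⁻¹ = (r - 1) - (r - 1) ^ 2 * r⁻¹ := by
    field_simp
    ring
  have hr9 : r⁻¹ ≤ 9 := by
    rw [inv_le_comm₀ hr0 (by norm_num)]
    linarith
  have hmul : (r - 1) ^ 2 * r⁻¹ ≤ 100 * (1 / x ^ 2) * 9 :=
    mul_le_mul hsq hr9 (by positivity) (by positivity)
  have h8 : 8 / x ^ 2 = 8 * (1 / x ^ 2) := by ring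
  have hx0 : 0 ≤ 1 / x ^ 2 := by positivity
  rw [abs_le] at h ⊢
  constructor <;> linarith

/-- A product over `p ≤ N`, `p ≡ 3 (mod 4)`, of factors `1 ± 2 / p + O(1 / p ^ 2)` is of order
`(log N) ^ (±1)`, uniformly in the factors. -/
theorem exists_abs_log_prod_sub_le :
    ∃ B : ℝ, ∀ (s : ℝ) (r : ℕ → ℝ), |s| = 1 →
      (∀ p : ℕ, p.Prime → p % 4 = 3 → |r p - (1 + s * (2 / p))| ≤ 8 / (p : ℝ) ^ 2) →
      (∀ p : ℕ, p.Prime → p % 4 = 3 → 1 / 9 ≤ r p) → ∀ N : ℕ, 2 ≤ N →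
      |Real.log (∏ p ∈ primesThreeModFour N, r p) - s * Real.log (Real.log N)| ≤ B := by
  obtain ⟨B, hB⟩ := exists_abs_sum_inv_sub_half_log_log_le
  have hsum : Summable fun n : ℕ => 1 / (n : ℝ) ^ 2 :=
    Real.summable_one_div_nat_pow.2 one_lt_two
  refine ⟨908 * ∑' n : ℕ, 1 / (n : ℝ) ^ 2 + 2 * B, fun s r hs h1 h2 N hN => ?_⟩
  rw [Real.log_prod fun p hp => by
    obtain ⟨-, hp, h3⟩ := mem_primesThreeModFour.1 hp
    have := h2 p hp h3
    linarith]
  have hpt : |∑ p ∈ primesThreeModFour N, Real.log (r p) -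
      s * (2 * ∑ p ∈ primesThreeModFour N, 1 / (p : ℝ))| ≤ 908 * ∑' n : ℕ, 1 / (n : ℝ) ^ 2 := by
    rw [Finset.mul_sum, Finset.mul_sum, ← Finset.sum_sub_distrib]
    refine (Finset.abs_sum_le_sum_abs _ _).trans ?_
    refine le_trans ?_ (mul_le_mul_of_nonneg_left
      (hsum.sum_le_tsum (primesThreeModFour N) fun n _ => by positivity) (by norm_num))
    rw [Finset.mul_sum]
    refine Finset.sum_le_sum fun p hp => ?_
    obtain ⟨-, hp, h3⟩ := mem_primesThreeModFour.1 hp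
    rw [mul_one_div]
    exact abs_log_sub_le (by exact_mod_cast hp.one_le) hs (h1 p hp h3) (h2 p hp h3)
  have h3 : |s * (2 * ∑ p ∈ primesThreeModFour N, 1 / (p : ℝ)) - s * Real.log (Real.log N)| ≤
      2 * B := by
    rw [← mul_sub, abs_mul, hs, one_mul]
    have := hB N hN
    rw [abs_le] at this ⊢
    constructor <;> linarith
  calc _ ≤ _ := abs_sub_le _ (s * (2 * ∑ p ∈ primesThreeModFour N, 1 / (p : ℝ))) _
    _ ≤ _ := add_le_add hpt h3

/-! ### The modulus `N_k` -/

theorem infinite_primesThreeModFour :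
    (Set.ofPred fun p : ℕ => p.Prime ∧ p ≡ 3 [MOD 4]).Infinite :=
  Nat.infinite_setOfPred_prime_and_modEq (by norm_num) (by norm_num)

theorem primeThreeModFour_spec (i : ℕ) :
    (primeThreeModFour i).Prime ∧ primeThreeModFour i % 4 = 3 :=
  Nat.nth_mem_of_infinite infinite_primesThreeModFour i

theorem primeThreeModFour_strictMono : StrictMono primeThreeModFour :=
  Nat.nth_strictMono infinite_primesThreeModFour

theorem image_primeThreeModFour (j : ℕ) :
    (Finset.range (j + 1)).image primeThreeModFour = primesThreeModFour (primeThreeModFour j) := by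
  ext p
  rw [mem_primesThreeModFour, Finset.mem_image]
  constructor
  · rintro ⟨i, hi, rfl⟩
    rw [Finset.mem_range] at hi
    exact ⟨primeThreeModFour_strictMono.monotone (by omega), primeThreeModFour_spec i⟩
  · rintro ⟨hle, hp⟩
    have h : primeThreeModFour (Nat.count (fun p : ℕ => p.Prime ∧ p ≡ 3 [MOD 4]) p) = p :=
      Nat.nth_count (p := fun p : ℕ => p.Prime ∧ p ≡ 3 [MOD 4]) hp
    refine ⟨_, ?_, h⟩
    rw [Finset.mem_range, Nat.lt_succ_iff, ← primeThreeModFour_strictMono.le_iff_le, h]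
    exact hle

theorem prod_range_primeThreeModFour {M : Type*} [CommMonoid M] (g : ℕ → M) (j : ℕ) :
    ∏ i ∈ Finset.range (j + 1), g (primeThreeModFour i) =
      ∏ p ∈ primesThreeModFour (primeThreeModFour j), g p := by
  rw [← image_primeThreeModFour, Finset.prod_image primeThreeModFour_strictMono.injective.injOn]

theorem three_le_primeThreeModFour (j : ℕ) : 3 ≤ primeThreeModFour j := by
  have := (primeThreeModFour_spec j).2
  omega

theorem log_primorialThreeModFour (j : ℕ) :
    Real.log (primorialThreeModFour (j + 1)) =
      ∑ p ∈ primesThreeModFour (primeThreeModFour j), Real.log p := by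
  rw [primorialThreeModFour, prod_range_primeThreeModFour (fun p => p), Nat.cast_prod,
    Real.log_prod]
  intro p hp
  exact_mod_cast (mem_primesThreeModFour.1 hp).2.1.ne_zero

/-- By the Chinese remainder theorem the ratio for `N_k ^ t` is the product of the local ratios. -/
theorem c₂_primorialThreeModFour_pow {a : ℤ}
    (hcop : ∀ i : ℕ, IsCoprime a (primeThreeModFour i : ℤ)) {t : ℕ} (ht : t ≠ 0) (j : ℕ) :
    c₂ a (primorialThreeModFour (j + 1) ^ t) =
      ∏ p ∈ primesThreeModFour (primeThreeModFour j),
        (numHyperbolaSums a (p ^ t) : ℝ) / numHyperbolaSums (-a) (p ^ t) := by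
  have hpw : ∀ s : Finset ℕ, (s : Set ℕ).Pairwise fun i l =>
      (primeThreeModFour i ^ t).Coprime (primeThreeModFour l ^ t) := fun s i _ l _ hil =>
    Nat.Coprime.pow _ _ ((Nat.coprime_primes (primeThreeModFour_spec i).1
      (primeThreeModFour_spec l).1).2 (primeThreeModFour_strictMono.injective.ne hil))
  have hN : primorialThreeModFour (j + 1) ^ t =
      ∏ i ∈ Finset.range (j + 1), primeThreeModFour i ^ t := by
    rw [primorialThreeModFour, Finset.prod_pow]
  have h2 : 2 ≤ primorialThreeModFour (j + 1) ^ t := by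
    have h3 : primeThreeModFour j ∣ primorialThreeModFour (j + 1) :=
      Finset.dvd_prod_of_mem _ (by simp)
    have hpos : 0 < primorialThreeModFour (j + 1) :=
      Finset.prod_pos fun i _ => (primeThreeModFour_spec i).1.pos
    have := Nat.le_of_dvd hpos h3
    have := three_le_primeThreeModFour j
    have := Nat.le_self_pow ht (primorialThreeModFour (j + 1))
    omega
  have hco : IsCoprime a ((primorialThreeModFour (j + 1) ^ t : ℕ) : ℤ) := by
    rw [hN, Nat.cast_prod]
    refine IsCoprime.prod_right fun i _ => ?_
    rw [Nat.cast_pow]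
    exact (hcop i).pow_right
  rw [c₂_eq_numHyperbolaSums_div h2 hco, hN, numHyperbolaSums_prod _ _ (hpw _),
    numHyperbolaSums_prod _ _ (hpw _), Nat.cast_prod, Nat.cast_prod, ← Finset.prod_div_distrib,
    prod_range_primeThreeModFour
      (fun p => (numHyperbolaSums a (p ^ t) : ℝ) / numHyperbolaSums (-a) (p ^ t))]

theorem exp_mul_le_and_le_of_abs_log_sub_le {R x B : ℝ} (hR : 0 < R) (hx : 0 < x)
    (h : |Real.log R - Real.log x| ≤ B) : Real.exp (-B) * x ≤ R ∧ R ≤ Real.exp B * x := by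
  rw [abs_le] at h
  constructor
  · rw [← Real.log_le_log_iff (by positivity) hR, Real.log_mul (Real.exp_ne_zero _) hx.ne',
      Real.log_exp]
    linarith
  · rw [← Real.log_le_log_iff hR (by positivity), Real.log_mul (Real.exp_ne_zero _) hx.ne',
      Real.log_exp]
    linarith

theorem mainTheorem7 (a : ℤ) (ha : IsSquare a)
    (hcop : ∀ i : ℕ, IsCoprime a (primeThreeModFour i : ℤ)) :
    (∃ c C : ℝ, 0 < c ∧ 0 < C ∧ ∀ k : ℕ, 1 ≤ k →
      c * Real.log (Real.log (primorialThreeModFour k)) ≤ c₂ a (primorialThreeModFour k) ∧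
      c₂ a (primorialThreeModFour k) ≤ C * Real.log (Real.log (primorialThreeModFour k))) ∧
    (∃ c C : ℝ, 0 < c ∧ 0 < C ∧ ∀ t : ℕ, 2 ≤ t → ∀ k : ℕ, 1 ≤ k →
      c * (Real.log (Real.log (primorialThreeModFour k)))⁻¹
          ≤ c₂ a (primorialThreeModFour k ^ t) ∧
      c₂ a (primorialThreeModFour k ^ t)
          ≤ C * (Real.log (Real.log (primorialThreeModFour k)))⁻¹) := by
  obtain ⟨b, rfl⟩ := ha
  rw [← sq] at *
  have hb : ∀ p : ℕ, p.Prime → p % 4 = 3 → (b : ZMod p) ≠ 0 := by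
    intro p hp h3 h0
    have h : primeThreeModFour (Nat.count (fun p : ℕ => p.Prime ∧ p ≡ 3 [MOD 4]) p) = p :=
      Nat.nth_count (p := fun p : ℕ => p.Prime ∧ p ≡ 3 [MOD 4]) ⟨hp, h3⟩
    have hc := hcop (Nat.count (fun p : ℕ => p.Prime ∧ p ≡ 3 [MOD 4]) p)
    rw [h] at hc
    have hdvd : (p : ℤ) ∣ b ^ 2 := ((ZMod.intCast_zmod_eq_zero_iff_dvd b p).1 h0).trans
      (dvd_pow_self b two_ne_zero)
    exact (Nat.prime_iff_prime_int.1 hp).not_isUnit (hc.isUnit_of_dvd' hdvd dvd_rfl)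
  obtain ⟨A, hA, hsize⟩ := exists_log_sum_log_primesThreeModFour_bounds
  obtain ⟨B, hB⟩ := exists_abs_log_prod_sub_le
  constructor
  · refine ⟨Real.exp (-B) / 2, Real.exp B * A, by positivity, by positivity, fun k hk => ?_⟩
    obtain ⟨j, rfl⟩ : ∃ j, k = j + 1 := ⟨k - 1, by omega⟩
    have h3 := three_le_primeThreeModFour j
    obtain ⟨-, hlo, hup⟩ := hsize _ h3
    have hprod := hB 1 (fun p => (numHyperbolaSums (b ^ 2) p : ℝ) / numHyperbolaSums (-b ^ 2) p)
      abs_one (fun p hp h3 => by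
        have : Fact p.Prime := ⟨hp⟩
        simpa using abs_ratio_prime_sub_le h3 (hb p hp h3))
      (fun p hp h3 => by
        have : Fact p.Prime := ⟨hp⟩
        have := one_le_ratio_prime h3 (hb p hp h3)
        linarith) _ (by omega : 2 ≤ primeThreeModFour j)
    have hc := c₂_primorialThreeModFour_pow hcop one_ne_zero j
    simp only [pow_one] at hc
    have hpos : 0 < c₂ (b ^ 2) (primorialThreeModFour (j + 1)) := by
      rw [hc]
      refine Finset.prod_pos fun p hp => ?_
      obtain ⟨-, hp, h3⟩ := mem_primesThreeModFour.1 hp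
      have : Fact p.Prime := ⟨hp⟩
      exact zero_lt_one.trans_le (one_le_ratio_prime h3 (hb p hp h3))
    rw [← hc, one_mul] at hprod
    obtain ⟨h1, h2⟩ := exp_mul_le_and_le_of_abs_log_sub_le hpos
      (Real.log_pos (by exact_mod_cast (by omega : 1 < primeThreeModFour j))) hprod
    rw [log_primorialThreeModFour]
    constructor
    · refine le_trans ?_ h1
      rw [div_mul_eq_mul_div, div_le_iff₀ two_pos, mul_assoc, mul_comm _ (2 : ℝ)]
      gcongr
    · refine h2.trans ?_
      rw [mul_assoc]
      gcongr
  · refine ⟨Real.exp (-B) / A, Real.exp B * 2, by positivity, by positivity,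
      fun t ht k hk => ?_⟩
    obtain ⟨j, rfl⟩ : ∃ j, k = j + 1 := ⟨k - 1, by omega⟩
    obtain ⟨t, rfl⟩ : ∃ u, t = u + 2 := ⟨t - 2, by omega⟩
    have h3 := three_le_primeThreeModFour j
    obtain ⟨hθ, hlo, hup⟩ := hsize _ h3
    have hprod := hB (-1) (fun p => (numHyperbolaSums (b ^ 2) (p ^ (t + 2)) : ℝ) /
        numHyperbolaSums (-b ^ 2) (p ^ (t + 2)))
      (by simp) (fun p hp h3 => by
        have : Fact p.Prime := ⟨hp⟩
        simpa [sub_eq_add_neg] using abs_ratio_prime_pow_sub_le h3 (hb p hp h3))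
      (fun p hp h3 => by
        have : Fact p.Prime := ⟨hp⟩
        exact one_div_nine_le_ratio_prime_pow h3 (hb p hp h3)) _
      (by omega : 2 ≤ primeThreeModFour j)
    have hc := c₂_primorialThreeModFour_pow hcop (show t + 2 ≠ 0 by omega) j
    have hpos : 0 < c₂ (b ^ 2) (primorialThreeModFour (j + 1) ^ (t + 2)) := by
      rw [hc]
      refine Finset.prod_pos fun p hp => ?_
      obtain ⟨-, hp, h3⟩ := mem_primesThreeModFour.1 hp
      have : Fact p.Prime := ⟨hp⟩
      have := one_div_nine_le_ratio_prime_pow (t := t) h3 (hb p hp h3)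
      linarith
    have hl : 0 < Real.log (primeThreeModFour j) :=
      Real.log_pos (by exact_mod_cast (by omega : 1 < primeThreeModFour j))
    rw [← hc, neg_one_mul, ← Real.log_inv] at hprod
    obtain ⟨h1, h2⟩ := exp_mul_le_and_le_of_abs_log_sub_le hpos (inv_pos.2 hl) hprod
    rw [log_primorialThreeModFour]
    constructor
    · refine le_trans ?_ h1
      rw [div_eq_mul_inv, mul_assoc, ← mul_inv]
      gcongr
    · refine h2.trans ?_
      rw [mul_assoc]
      gcongr
      rw [inv_le_iff_one_le_mul₀ hl, mul_assoc, inv_mul_eq_div, mul_div_assoc',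
        le_div_iff₀ hθ]
      linarith
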